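/- Let $d\ge 1$, let $X$ be a finite set, and let $\rho(k,i)=\max_\nu|k_\nu-i_\nu|$ on $\mathbb Z^d$; for a finite nonempty $M\subset\mathbb Z^d$ put $\rho(k,M)=\min_{j\in M}\rho(k,j)$. For finite $\Lambda\subset\mathbb Z^d$, a bar denotes configurations outside: $\bar x_\Lambda=(x_i)_{i\notin\Lambda}$. Let $\{q_\Lambda(\cdot\mid\bar x_\Lambda)\}$ be an ensemble of conditional distributions, i.e. for every finite $\Lambda\subset\mathbb Z^d$ and every outside configuration $\bar x_\Lambda$ a probability measure on $X^\Lambda$, satisfying the compatibility conditions $$q_\Lambda(x_\Lambda\mid\bar x_\Lambda)=q_{\Lambda\setminus M}(x_{\Lambda\setminus M}\mid\bar x_\Lambda)\; q_M(x_M\mid\bar x_M)\qquad(M\subset\Lambda,\ x\in X^{\mathbb Z^d}),$$ where, for $N\subset\Lambda$, $q_N(\cdot\mid\bar x_\Lambda)$ is the marginal of $q_\Lambda(\cdot\mid\bar x_\Lambda)$ on $X^N$. Write $|r-s|=\sup_A|r(A)-s(A)|$ for the variational distance of probability measures $r,s$, and, for probability measures on $X^\Lambda$, $$W_2(r,s)=\min_\pi\Bigl(\sum_{i\in\Lambda}\Pr_\pi\{Z_i\ne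 U_i\}^2\Bigr)^{1/2},$$ the minimum being over all couplings $\pi=\mathcal L(Z,U)$ of $r$ and $s$. Let $\varphi:\mathbb Z_+\to\mathbb R_+$ satisfy $\|\Phi\|:=\sum_{i\in\mathbb Z^d}\varphi(\rho(0,i))<\infty$ (the common row sum of the matrix $\Phi=(\varphi(\rho(k,i)))_{k,i\in\mathbb Z^d}$). Assume strong mixing with coupling function $\varphi$: for all finite $\Lambda\subset\mathbb Z^d$, all nonempty $M\subset\Lambda$, and all outside configurations $\bar y_\Lambda,\bar z_\Lambda$ differing only at one site $k\notin\Lambda$, $$|q_M(\cdot\mid\bar y_\Lambda)-q_M(\cdot\mid\bar z_\Lambda)|\le\varphi(\rho(k,M)).$$ For an integer $m\ge1$ set $$\Theta_m=\min_{R\in\mathbb Z_+}\Bigl[\|\Phi\|\,\frac{dR}{m}+2d\sum_{r=R}^\infty(2r+1)^{d-1}\varphi(r)\Bigr].$$ Fix a finite $\Lambda\subset\mathbb Z^d$, an outside configuration $\bar y_\Lambda$ and a probability measure $p_\Lambda$ on $X^\Lambda$. Let $Y$ be a random configuration on $\mathbb Z^d$ with $\mathcal L(Y_\Lambda)=p_\Lambda$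 and $\bar Y_\Lambda=\bar y_\Lambda$, and for $M\subset\Lambda$ let $p_M(\cdot\mid\bar Y_M)$ be the conditional distribution of $Y_M$ given $\bar Y_M$. Let $\mathcal I_m$ be the set of cubes in $\mathbb Z^d$ with $m$ sites along each side that intersect $\Lambda$. If $\Theta_m<1$, then $$\begin{aligned} W_2^2\bigl(p_\Lambda,q_\Lambda(\cdot\mid\bar y_\Lambda)\bigr) &\le\frac1{m^d}\,\frac1{(1-\Theta_m)^2}\sum_{I\in\mathcal I_m}\mathbb E\,W_2^2\bigl(p_{I\cap\Lambda}(\cdot\mid\bar Y_{I\cap\Lambda}),q_{I\cap\Lambda}(\cdot\mid\bar Y_{I\cap\Lambda})\bigr)\\ &\le\frac1{(1-\Theta_m)^2}\sum_{I\in\mathcal I_m}\mathbb E\,\bigl|p_{I\cap\Lambda}(\cdot\mid\bar Y_{I\cap\Lambda})-q_{I\cap\Lambda}(\cdot\mid\bar Y_{I\cap\Lambda})\bigr|^2 . \end{aligned}$$ If (without assuming $\Theta_m<1$) the ensemble has finite range of interaction $R\in\mathbb Z_+$ (for every finite $\Lambda$, $q_\Lambda(\cdot\mid\bar x_\Lambda)$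 depends only on the $x_k$, $k\notin\Lambda$, with $\rho(k,j)\le R$ for some $j\in\Lambda$), then the same holds with $\|\Phi\|\,dR/m$ in place of $\Theta_m$, both in the hypothesis $\Theta_m<1$ (which is then replaced by $\|\Phi\|\,dR/m<1$) and in the two inequalities. -/

import Mathlib

namespace SpinSystem

/-- Sites of the `d`-dimensional cubic lattice. -/
abbrev Site (d : ℕ) : Type := Fin d → ℤ

/-- The lattice distance `ρ(k, i) = max_ν |k_ν - i_ν|`. -/
def rho {d : ℕ} (k i : Site d) : ℕ :=
  Finset.univ.sup fun ν => (k ν - i ν).natAbs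

/-- The distance `ρ(k, M) = min_{j ∈ M} ρ(k, j)` of a site from a nonempty finite set. -/
def rhoSet {d : ℕ} (k : Site d) (M : Finset (Site d)) (hM : M.Nonempty) : ℕ :=
  M.inf' hM (rho k)

section FiniteProbability

/-! Laws on a finite set `α` are vectors `r : α → ℝ` in `stdSimplex ℝ α`. -/

/-- The variational distance `sup_A |r(A) - s(A)|`. -/
noncomputable def varDist {α : Type*} (r s : α → ℝ) : ℝ :=
  ⨆ A : Finset α, |∑ a ∈ A, r a - ∑ a ∈ A, s a|

/-- `π` is a joint law with marginals `r` and `s`. -/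
def IsCoupling {α : Type*} [Fintype α] (π : α × α → ℝ) (r s : α → ℝ) : Prop :=
  π ∈ stdSimplex ℝ (α × α) ∧ (∀ a, ∑ b, π (a, b) = r a) ∧ (∀ b, ∑ a, π (a, b) = s b)

/-- The probability under `π` that the two configurations differ at the coordinate `i`. -/
def probNe {ι X : Type*} [Fintype ι] [DecidableEq ι] [Fintype X] [DecidableEq X]
    (π : (ι → X) × (ι → X) → ℝ) (i : ι) : ℝ :=
  ∑ zu : (ι → X) × (ι → X) with zu.1 i ≠ zu.2 i, π zu

/-- `W₂(r, s)`: the minimum of `√(∑ i, Pr_π{Z_i ≠ U_i}²)` over all couplings `π` of `r` and `s`.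
(For probability vectors the set of couplings is nonempty and compact and the quantity is
continuous in `π`, so that this infimum is a minimum.) -/
noncomputable def W2 {ι X : Type*} [Fintype ι] [DecidableEq ι] [Fintype X] [DecidableEq X]
    (r s : (ι → X) → ℝ) : ℝ :=
  sInf {c | ∃ π, IsCoupling π r s ∧ c = Real.sqrt (∑ i, probNe π i ^ 2)}

end FiniteProbability

section Configurations

variable {d : ℕ} {X : Type*}

/-- The configuration outside of `Λ` given by a configuration on the whole lattice. -/
def outside (Λ : Finset (Site d)) (x : Site d → X) : {i // i ∉ Λ} → X := fun i => x i

/-- The configuration on the whole lattice equal to `z` on `Λ` and to `η` outside of `Λ`. -/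
def join (Λ : Finset (Site d)) (z : Λ → X) (η : {i // i ∉ Λ} → X) : Site d → X :=
  fun i => if h : i ∈ Λ then z ⟨i, h⟩ else η ⟨i, h⟩

/-- For `M ⊆ Λ`, the marginal on `X^M` of a law on `X^Λ`. -/
def marginal [Fintype X] [DecidableEq X] {M Λ : Finset (Site d)} (h : M ⊆ Λ)
    (r : (Λ → X) → ℝ) (z : M → X) : ℝ :=
  ∑ w : Λ → X with Finset.restrict₂ (π := fun _ => X) h w = z, r w

/-- For a law `p` on `X^Λ` and `M ⊆ Λ`, the conditional law of the coordinates in `M` given that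
the coordinates in `Λ \ M` are those of `x`. It is meaningful when this event has positive
probability. -/
noncomputable def condLaw [Fintype X] {Λ : Finset (Site d)} (p : (Λ → X) → ℝ)
    (M : Finset (Site d)) (x : Site d → X) (z : M → X) : ℝ :=
  p (Λ.restrict (join M z (outside M x))) /
    ∑ z' : M → X, p (Λ.restrict (join M z' (outside M x)))

end Configurations

/-- A compatible ensemble of conditional distributions `q_Λ(· | x̄_Λ)`: for every finite `Λ` and
every outside configuration a law on `X^Λ`, such that for all `M ⊆ Λ`
`q_Λ(x_Λ | x̄_Λ) = q_{Λ \ M}(x_{Λ \ M} | x̄_Λ) · q_M(x_M | x̄_M)`, where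
`q_{Λ \ M}(· | x̄_Λ)` is the marginal of `q_Λ(· | x̄_Λ)`. -/
structure Ensemble (d : ℕ) (X : Type*) [Fintype X] where
  law : (Λ : Finset (Site d)) → ({i // i ∉ Λ} → X) → (Λ → X) → ℝ
  law_mem : ∀ (Λ : Finset (Site d)) (η : {i // i ∉ Λ} → X), law Λ η ∈ stdSimplex ℝ (Λ → X)
  compat : ∀ M Λ : Finset (Site d), M ⊆ Λ → ∀ x : Site d → X,
    law Λ (outside Λ x) (Λ.restrict x) =
      (∑ z : M → X, law Λ (outside Λ x) (Λ.restrict (join M z (outside M x)))) *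
        law M (outside M x) (M.restrict x)

/-- `φ : ℤ₊ → ℝ₊` with `∑_{i ∈ ℤ^d} φ(ρ(0, i)) < ∞`. -/
structure IsCouplingFunction (d : ℕ) (φ : ℕ → ℝ) : Prop where
  nonneg : ∀ r, 0 ≤ φ r
  summable : Summable fun i : Site d => φ (rho 0 i)

/-- Strong mixing: for `M ⊆ Λ` finite and outside configurations `y`, `z` of `Λ` that differ only
at one site `k ∉ Λ`, `|q_M(· | ȳ_Λ) - q_M(· | z̄_Λ)| ≤ φ(ρ(k, M))`. -/
def StronglyMixing {d : ℕ} {X : Type*} [Fintype X] [DecidableEq X]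
    (q : Ensemble d X) (φ : ℕ → ℝ) : Prop :=
  ∀ (M Λ : Finset (Site d)) (h : M ⊆ Λ) (hM : M.Nonempty) (k : {i // i ∉ Λ})
    (y z : {i // i ∉ Λ} → X), (∀ i, i ≠ k → y i = z i) →
    varDist (marginal h (q.law Λ y)) (marginal h (q.law Λ z)) ≤ φ (rhoSet k M hM)

/-- Finite range of interaction `R`: `q_Λ(· | x̄_Λ)` depends only on the coordinates of `x̄_Λ` in
the `R`-neighborhood of `Λ`. -/
def HasFiniteRange {d : ℕ} {X : Type*} [Fintype X] (q : Ensemble d X) (R : ℕ) : Prop :=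
  ∀ (Λ : Finset (Site d)) (y z : {i // i ∉ Λ} → X),
    (∀ k : {i // i ∉ Λ}, (∃ j ∈ Λ, rho k.1 j ≤ R) → y k = z k) → q.law Λ y = q.law Λ z

/-- `‖Φ‖ = ∑_{i ∈ ℤ^d} φ(ρ(0, i))`, the common row sum of the matrix `Φ = (φ(ρ(k, i)))`. -/
noncomputable def normPhi (d : ℕ) (φ : ℕ → ℝ) : ℝ := ∑' i : Site d, φ (rho 0 i)

/-- `Θ_m = min_R [ ‖Φ‖ d R / m + 2 d ∑_{r ≥ R} (2 r + 1)^(d - 1) φ(r) ]`, with `r = R + j`. -/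
noncomputable def Theta (d : ℕ) (φ : ℕ → ℝ) (m : ℕ) : ℝ :=
  ⨅ R : ℕ, (normPhi d φ * ((d : ℝ) * R / m) +
    2 * d * ∑' j : ℕ, (2 * ((R + j : ℕ) : ℝ) + 1) ^ (d - 1) * φ (R + j))

/-- The cube with lowest corner `a` and `m` sites along each side. -/
noncomputable def cube {d : ℕ} (m : ℕ) (a : Site d) : Finset (Site d) :=
  Fintype.piFinset fun ν => Finset.Ico (a ν) (a ν + m)

theorem finite_cubes {d : ℕ} (m : ℕ) (Λ : Finset (Site d)) :
    {I : Finset (Site d) | (∃ a, I = cube m a) ∧ (I ∩ Λ).Nonempty}.Finite := by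
  refine (Finset.finite_toSet ((Λ.biUnion fun i =>
    Fintype.piFinset fun ν => Finset.Ioc (i ν - m) (i ν)).image (cube m))).subset ?_
  rintro I ⟨⟨a, rfl⟩, i, hi⟩
  rw [Finset.mem_inter, cube, Fintype.mem_piFinset] at hi
  simp only [Finset.coe_image, Set.mem_image, Finset.mem_coe, Finset.mem_biUnion]
  refine ⟨a, ⟨i, hi.2, ?_⟩, rfl⟩
  rw [Fintype.mem_piFinset]
  intro ν
  have := hi.1 ν
  rw [Finset.mem_Ico] at this
  rw [Finset.mem_Ioc]
  omega

/-- `ℐ_m(Λ)`, the set of `m`-sided cubes that intersect `Λ`. -/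
noncomputable def cubes {d : ℕ} (m : ℕ) (Λ : Finset (Site d)) : Finset (Finset (Site d)) :=
  (finite_cubes m Λ).toFinset

section Sums

variable {d : ℕ} {X : Type*} [Fintype X] [DecidableEq X]

/-- `∑_{I ∈ ℐ_m} E W₂²(p_{I ∩ Λ}(· | Ȳ_{I ∩ Λ}), q_{I ∩ Λ}(· | Ȳ_{I ∩ Λ}))`, where `Y` has law `p`
on `Λ` and equals `η` outside of `Λ`. -/
noncomputable def sumW2 (q : Ensemble d X) (m : ℕ) (Λ : Finset (Site d))
    (η : {i // i ∉ Λ} → X) (p : (Λ → X) → ℝ) : ℝ :=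
  ∑ I ∈ cubes m Λ, ∑ y : Λ → X, p y *
    W2 (condLaw p (I ∩ Λ) (join Λ y η)) (q.law (I ∩ Λ) (outside (I ∩ Λ) (join Λ y η))) ^ 2

/-- `∑_{I ∈ ℐ_m} E |p_{I ∩ Λ}(· | Ȳ_{I ∩ Λ}) - q_{I ∩ Λ}(· | Ȳ_{I ∩ Λ})|²`, where `Y` has law `p`
on `Λ` and equals `η` outside of `Λ`. -/
noncomputable def sumVar (q : Ensemble d X) (m : ℕ) (Λ : Finset (Site d))
    (η : {i // i ∉ Λ} → X) (p : (Λ → X) → ℝ) : ℝ :=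
  ∑ I ∈ cubes m Λ, ∑ y : Λ → X, p y *
    varDist (condLaw p (I ∩ Λ) (join Λ y η))
      (q.law (I ∩ Λ) (outside (I ∩ Λ) (join Λ y η))) ^ 2

end Sums

end SpinSystem

/-!
The proof compares `p` with `q = q_Λ(· | η)` through one step of the Gibbs sampler that picks a cube
`I` meeting `Λ` uniformly among all `N` of them and resamples the sites of `I ∩ Λ` from the
conditional law of the ensemble. By compatibility this step leaves `q` invariant
(`sum_mul_push_law`), so the triangle inequality for `W₂` gives
`W₂(p, q) ≤ W₂(p, p') + W₂(p', q)`, where `p'` is the law after one step started from `p`.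

* `p` is invariant under resampling from its own conditional laws, so coupling the two resampling
  mechanisms cube by cube bounds `W₂(p, p')²` by `m ^ d / N ^ 2` times the first sum of the theorem
  (`exists_coupledWithin_resample_self`); the factor `m ^ d` is the number of cubes through a site.
* The step contracts: `W₂(p', q) ≤ (1 - (m ^ d / N) (1 - Θ)) W₂(p, q)`. Resampling the same cube from
  two configurations that differ at one site `k` off the cube, a site `i` of the cube can be made to
  disagree with probability at most `φ(ρ(k, i))`, for all `i` at once. This needs one coupling that
  is maximal for the restrictions to all sets `{i | n ≤ ρ(k, i)}`, and Goldstein's construction for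
  successively coarser observables provides it (`exists_coupling_levels`). Strong mixing bounds the
  disagreement of each restriction (`StronglyMixing.coupledWithin`). Several sites of disagreement
  are treated one after another, by gluing.

Averaged over the cubes, the influence of `k` on `i` is at most `φ(ρ(k, i))` times the proportion of
the cubes through `i` that miss `k`, which is at most `min 1 (d ρ(k, i) / m)`, or `d R / m` for
interactions of range `R`. The resulting matrix is symmetric with row sums at most `Θ`, so by Schur's
test its `ℓ²`-norm is at most `Θ`. Collecting the two bounds on `W₂(p, q)` yields the first
inequality (`W2_sq_le_of_contraction`). The second one follows from a maximal coupling on each cube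
(`W2_sq_le_card_mul_varDist_sq`).
-/

namespace SpinSystem

/-! ### Maximal couplings along successively coarser observables -/

section Levels

variable {α : Type*} [Fintype α]

/-- The image of the (unnormalized) law `r` under `f`. -/
def push {β : Type*} [DecidableEq β] (f : α → β) (r : α → ℝ) (b : β) : ℝ :=
  ∑ x with f x = b, r x

theorem push_nonneg {β : Type*} [DecidableEq β] (f : α → β) {r : α → ℝ} (hr : ∀ x, 0 ≤ r x)
    (b : β) : 0 ≤ push f r b :=
  Finset.sum_nonneg fun x _ => hr x

theorem le_push {β : Type*} [DecidableEq β] (f : α → β) {r : α → ℝ} (hr : ∀ x, 0 ≤ r x)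
    (x : α) : r x ≤ push f r (f x) :=
  Finset.single_le_sum (f := r) (fun x _ => hr x) (by simp)

theorem sum_push {β : Type*} [Fintype β] [DecidableEq β] (f : α → β) (r : α → ℝ) :
    ∑ b, push f r b = ∑ x, r x :=
  Finset.sum_fiberwise _ _ _

theorem push_sub {β : Type*} [DecidableEq β] (f : α → β) (r r' : α → ℝ) (b : β) :
    push f (fun x => r x - r' x) b = push f r b - push f r' b :=
  Finset.sum_sub_distrib _ _

/-- The part of `r` that remains when its image under `f` is thinned to `c`. -/
noncomputable def thin {β : Type*} [DecidableEq β] (f : α → β) (r : α → ℝ) (c : β → ℝ) (x : α) :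
    ℝ :=
  r x * (c (f x) / push f r (f x))

section Thin

variable {β : Type*} [DecidableEq β] {f : α → β} {r : α → ℝ} {c : β → ℝ}

theorem thin_nonneg (hr : ∀ x, 0 ≤ r x) (hc : ∀ b, 0 ≤ c b) (x : α) : 0 ≤ thin f r c x :=
  mul_nonneg (hr x) (div_nonneg (hc _) (push_nonneg f hr _))

theorem thin_le (hr : ∀ x, 0 ≤ r x) (hcr : ∀ b, c b ≤ push f r b) (x : α) :
    thin f r c x ≤ r x :=
  mul_le_of_le_one_right (hr x) (div_le_one_of_le₀ (hcr _) (push_nonneg f hr _))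

theorem push_thin (hr : ∀ x, 0 ≤ r x) (hc : ∀ b, 0 ≤ c b) (hcr : ∀ b, c b ≤ push f r b) (b : β) :
    push f (thin f r c) b = c b := by
  have h1 : push f (thin f r c) b = push f r b * (c b / push f r b) := by
    rw [push, push, Finset.sum_mul]
    refine Finset.sum_congr rfl fun x hx => ?_
    rw [Finset.mem_filter] at hx
    rw [thin, hx.2, push]
  rw [h1]
  rcases (push_nonneg f hr b).eq_or_lt with h0 | h0
  · have := hcr b
    have := hc b
    rw [← h0]
    linarith
  · field_simp

end Thin

/-- Two laws with the same image `c` under `f` have a coupling supported on `f x = f y`. -/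
theorem exists_coupling_of_push_eq {β : Type*} [DecidableEq β] (f : α → β) {r s : α → ℝ}
    (hr : ∀ x, 0 ≤ r x) (hs : ∀ x, 0 ≤ s x) (hrs : ∀ b, push f r b = push f s b) :
    ∃ π : α × α → ℝ, (∀ a, 0 ≤ π a) ∧ (∀ x, ∑ y, π (x, y) = r x) ∧ (∀ y, ∑ x, π (x, y) = s y) ∧
      ∀ x y, f x ≠ f y → π (x, y) = 0 := by
  refine ⟨fun a => if f a.2 = f a.1 then r a.1 * s a.2 / push f r (f a.1) else 0, fun a => ?_,
    fun x => ?_, fun y => ?_, fun x y h => if_neg fun h' => h h'.symm⟩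
  · dsimp only
    split_ifs
    · exact div_nonneg (mul_nonneg (hr _) (hs _)) (push_nonneg f hr _)
    · rfl
  · have h1 : ∑ y, (if f y = f x then r x * s y / push f r (f x) else 0) =
        r x * (push f s (f x) / push f r (f x)) := by
      have h2 : push f s (f x) = ∑ y with f y = f x, s y := rfl
      rw [← Finset.sum_filter, h2, Finset.sum_div, Finset.mul_sum]
      exact Finset.sum_congr rfl fun y _ => mul_div_assoc _ _ _
    refine h1.trans ?_
    rw [← hrs]
    rcases (push_nonneg f hr (f x)).eq_or_lt with h0 | h0
    · have h2 := le_push f hr x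
      have h3 := hr x
      have : r x = 0 := by linarith
      simp [this]
    · rw [div_self h0.ne', mul_one]
  · have h1 : ∑ x, (if f y = f x then r x * s y / push f r (f x) else 0) =
        s y * (push f r (f y) / push f r (f y)) := by
      conv_rhs => rw [push, Finset.sum_div, Finset.mul_sum, Finset.sum_filter]
      refine Finset.sum_congr rfl fun x _ => ?_
      by_cases h : f x = f y
      · rw [if_pos h, if_pos h.symm, h, push]
        ring
      · rw [if_neg h, if_neg (Ne.symm h)]
    refine h1.trans ?_
    rcases (push_nonneg f hr (f y)).eq_or_lt with h0 | h0
    · have h2 := le_push f hs y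
      have h3 := hs y
      rw [← hrs] at h2
      have : s y = 0 := by linarith
      simp [this]
    · rw [div_self h0.ne', mul_one]

/-- Goldstein's maximal coupling. Along a sequence of successively coarser observables `f l`,
`f (l + 1)`, …, two laws of equal mass have one coupling under which each of these observables
agrees with the largest possible probability. The common part of the images under the finest
observable is coupled first. As `min (a - c) (b - c) = min a b - c`, what this part takes away at
the coarser levels is counted there in full, and the remainders are coupled by induction. -/
theorem exists_coupling_levels {β : ℕ → Type*} [∀ n, Fintype (β n)] [∀ n, DecidableEq (β n)]
    (f : ∀ n, α → β n) (hf : ∀ i j, i ≤ j → ∀ x y, f i x = f i y → f j x = f j y) (n : ℕ) :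
    ∀ (l : ℕ) (r s : α → ℝ), (∀ x, 0 ≤ r x) → (∀ x, 0 ≤ s x) → ∑ x, r x = ∑ x, s x →
      ∃ π : α × α → ℝ, (∀ a, 0 ≤ π a) ∧ (∀ x, ∑ y, π (x, y) = r x) ∧
        (∀ y, ∑ x, π (x, y) = s y) ∧ ∀ j, l ≤ j → j < l + n →
          ∑ b, min (push (f j) r b) (push (f j) s b) ≤
            ∑ x, ∑ y, if f j x = f j y then π (x, y) else 0 := by
  induction n with
  | zero =>
    intro l r s hr hs hrs
    obtain ⟨π, h0, h1, h2, -⟩ := exists_coupling_of_push_eq (fun _ : α => ()) hr hs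
      (fun b => by simpa [push] using hrs)
    exact ⟨π, h0, h1, h2, fun j h h' => by omega⟩
  | succ n ih =>
    intro l r s hr hs hrs
    set c : β l → ℝ := fun b => min (push (f l) r b) (push (f l) s b) with hc
    have hc0 : ∀ b, 0 ≤ c b := fun b => le_min (push_nonneg _ hr _) (push_nonneg _ hs _)
    have hcr : ∀ b, c b ≤ push (f l) r b := fun b => min_le_left _ _
    have hcs : ∀ b, c b ≤ push (f l) s b := fun b => min_le_right _ _
    set r₁ := thin (f l) r c
    set s₁ := thin (f l) s c
    have hr₁ : ∀ b, push (f l) r₁ b = c b := push_thin hr hc0 hcr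
    have hs₁ : ∀ b, push (f l) s₁ b = c b := push_thin hs hc0 hcs
    obtain ⟨π₁, h₁0, h₁r, h₁s, h₁f⟩ := exists_coupling_of_push_eq (f l)
      (thin_nonneg hr hc0) (thin_nonneg hs hc0) (fun b => (hr₁ b).trans (hs₁ b).symm)
    have hmass : ∑ x, r₁ x = ∑ x, s₁ x := by
      rw [← sum_push (f l), ← sum_push (f l)]
      simp_rw [hr₁, hs₁]
    obtain ⟨π₂, h₂0, h₂r, h₂s, h₂f⟩ := ih (l + 1) (fun x => r x - r₁ x) (fun x => s x - s₁ x)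
      (fun x => sub_nonneg.2 (thin_le hr hcr x)) (fun x => sub_nonneg.2 (thin_le hs hcs x))
      (by rw [Finset.sum_sub_distrib, Finset.sum_sub_distrib, hrs, hmass])
    -- All of `π₁` agrees at every level from `l` on.
    have htot : ∀ j, l ≤ j → (∑ x, ∑ y, if f j x = f j y then π₁ (x, y) else 0) = ∑ x, r₁ x := by
      intro j hj
      refine Finset.sum_congr rfl fun x _ => Eq.trans ?_ (h₁r x)
      refine Finset.sum_congr rfl fun y _ => ?_
      split_ifs with h
      · rfl
      · exact (h₁f x y fun h' => h (hf l j hj x y h')).symm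
    have hpush : ∀ j, l ≤ j → ∀ b, push (f j) s₁ b = push (f j) r₁ b := by
      intro j hj b
      rw [push, push, Finset.sum_filter, Finset.sum_filter]
      have e1 : ∀ x, (if f j x = b then r₁ x else 0) =
          ∑ y, if f j x = b then π₁ (x, y) else 0 := by
        intro x
        split_ifs
        · exact (h₁r x).symm
        · simp
      have e2 : ∀ y, (if f j y = b then s₁ y else 0) =
          ∑ x, if f j y = b then π₁ (x, y) else 0 := by
        intro y
        split_ifs
        · exact (h₁s y).symm
        · simp
      simp_rw [e1, e2]
      rw [Finset.sum_comm]
      refine Finset.sum_congr rfl fun x _ => Finset.sum_congr rfl fun y _ => ?_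
      by_cases h : f l x = f l y
      · rw [hf l j hj x y h]
      · rw [h₁f x y h, ite_self, ite_self]
    refine ⟨fun a => π₁ a + π₂ a, fun a => add_nonneg (h₁0 a) (h₂0 a), fun x => ?_, fun y => ?_,
      fun j hj hj' => ?_⟩
    · rw [Finset.sum_add_distrib, h₁r, h₂r]
      ring
    · rw [Finset.sum_add_distrib, h₁s, h₂s]
      ring
    · have hsplit : (∑ x, ∑ y, if f j x = f j y then π₁ (x, y) + π₂ (x, y) else 0) =
          ∑ x, r₁ x + ∑ x, ∑ y, if f j x = f j y then π₂ (x, y) else 0 := by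
        rw [← htot j hj, ← Finset.sum_add_distrib]
        refine Finset.sum_congr rfl fun x _ => ?_
        rw [← Finset.sum_add_distrib]
        refine Finset.sum_congr rfl fun y _ => ?_
        split_ifs <;> simp
      rw [hsplit]
      rcases hj.eq_or_lt with rfl | hlt
      · have h0 : 0 ≤ ∑ x, ∑ y, if f l x = f l y then π₂ (x, y) else 0 :=
          Finset.sum_nonneg fun x _ => Finset.sum_nonneg fun y _ => by
            split_ifs
            · exact h₂0 _
            · rfl
        have : ∑ b, c b = ∑ x, r₁ x := by
          rw [← sum_push (f l)]
          simp_rw [hr₁]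
        linarith
      · refine le_trans (le_of_eq ?_) (add_le_add_right (h₂f j hlt (by omega)) _)
        rw [← sum_push (f j), ← Finset.sum_add_distrib]
        refine Finset.sum_congr rfl fun b _ => ?_
        rw [push_sub, push_sub, hpush j hj, min_sub_sub_right]
        ring

end Levels

/-! ### Variational distance -/

section VarDist

variable {α : Type*} [Fintype α] {r s : α → ℝ}

theorem abs_sum_sub_le_varDist (r s : α → ℝ) (A : Finset α) :
    |∑ a ∈ A, r a - ∑ a ∈ A, s a| ≤ varDist r s :=
  le_ciSup (f := fun A : Finset α => |∑ a ∈ A, r a - ∑ a ∈ A, s a|)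
    (Set.finite_range _).bddAbove A

theorem sum_sub_sum_min_le_varDist (r s : α → ℝ) :
    ∑ a, r a - ∑ a, min (r a) (s a) ≤ varDist r s := by
  classical
  refine le_trans (le_of_eq ?_) ((le_abs_self _).trans
    (abs_sum_sub_le_varDist r s (Finset.univ.filter fun a => s a < r a)))
  rw [← Finset.sum_sub_distrib, ← Finset.sum_sub_distrib, Finset.sum_filter]
  refine Finset.sum_congr rfl fun a _ => ?_
  split_ifs with h
  · rw [min_eq_right h.le]
  · rw [min_eq_left (not_lt.1 h), sub_self]

end VarDist

/-! ### Couplings of laws on configurations -/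

section Couplings

variable {ι X : Type*} [Fintype ι] [DecidableEq ι] [Fintype X] [DecidableEq X]
  {r s t : (ι → X) → ℝ} {v w : ι → ℝ}

/-- Some coupling of `r` and `s` has, for every `i`, probability at most `v i` that the two
configurations differ at the coordinate `i`. -/
def CoupledWithin (r s : (ι → X) → ℝ) (v : ι → ℝ) : Prop :=
  ∃ π, IsCoupling π r s ∧ ∀ i, probNe π i ≤ v i

theorem probNe_eq (π : (ι → X) × (ι → X) → ℝ) (i : ι) :
    probNe π i = ∑ x, ∑ y, if x i ≠ y i then π (x, y) else 0 := by
  rw [probNe, Finset.sum_filter, Fintype.sum_prod_type]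

theorem probNe_nonneg {π : (ι → X) × (ι → X) → ℝ} (hπ : ∀ a, 0 ≤ π a) (i : ι) : 0 ≤ probNe π i :=
  Finset.sum_nonneg fun a _ => hπ a

/-- A nonnegative function with the marginals of two laws is a coupling. -/
theorem isCoupling_of_marginals {α : Type*} [Fintype α] {π : α × α → ℝ} {r s : α → ℝ}
    (h0 : ∀ a, 0 ≤ π a) (hr : ∑ x, r x = 1) (h1 : ∀ x, ∑ y, π (x, y) = r x)
    (h2 : ∀ y, ∑ x, π (x, y) = s y) : IsCoupling π r s := by
  refine ⟨⟨h0, ?_⟩, h1, h2⟩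
  rw [Fintype.sum_prod_type]
  simp_rw [h1, hr]

theorem CoupledWithin.mono (h : CoupledWithin r s v) (hvw : ∀ i, v i ≤ w i) :
    CoupledWithin r s w := by
  obtain ⟨π, hπ, h⟩ := h
  exact ⟨π, hπ, fun i => (h i).trans (hvw i)⟩

theorem CoupledWithin.refl (hr : r ∈ stdSimplex ℝ (ι → X)) :
    CoupledWithin r r fun _ => 0 := by
  refine ⟨fun a => if a.1 = a.2 then r a.1 else 0,
    isCoupling_of_marginals (fun a => ?_) hr.2 (fun x => ?_) (fun y => ?_), fun i => ?_⟩
  · split_ifs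
    · exact hr.1 _
    · rfl
  · simp
  · simp
  · rw [probNe]
    refine (Finset.sum_eq_zero fun a ha => if_neg fun h => ?_).le
    rw [Finset.mem_filter, h] at ha
    exact ha.2 rfl

/-- The gluing lemma. -/
theorem CoupledWithin.trans (h₁ : CoupledWithin r s v) (h₂ : CoupledWithin s t w) :
    CoupledWithin r t fun i => v i + w i := by
  obtain ⟨π, ⟨hπ, hπr, hπs⟩, hv⟩ := h₁
  obtain ⟨σ, ⟨hσ, hσs, hσt⟩, hw⟩ := h₂
  have hs0 : ∀ y, 0 ≤ s y := fun y => by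
    rw [← hπs]
    exact Finset.sum_nonneg fun x _ => hπ.1 _
  have hπ0 : ∀ x y, s y = 0 → π (x, y) = 0 := fun x y h =>
    (Finset.sum_eq_zero_iff_of_nonneg fun x _ => hπ.1 _).1 ((hπs y).trans h) x (Finset.mem_univ _)
  have hσ0 : ∀ y z, s y = 0 → σ (y, z) = 0 := fun y z h =>
    (Finset.sum_eq_zero_iff_of_nonneg fun x _ => hσ.1 _).1 ((hσs y).trans h) z (Finset.mem_univ _)
  -- The joint law of three configurations under which the outer two are independent given the
  -- middle one; where `s y = 0`, division by zero gives the correct value `0`.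
  have hT0 : ∀ x y z, 0 ≤ π (x, y) * σ (y, z) / s y := fun x y z =>
    div_nonneg (mul_nonneg (hπ.1 _) (hσ.1 _)) (hs0 y)
  have hTz : ∀ x y, ∑ z, π (x, y) * σ (y, z) / s y = π (x, y) := by
    intro x y
    rw [← Finset.sum_div, ← Finset.mul_sum, hσs]
    by_cases h : s y = 0
    · rw [hπ0 x y h, zero_mul, zero_div]
    · rw [mul_div_cancel_right₀ _ h]
  have hTx : ∀ y z, ∑ x, π (x, y) * σ (y, z) / s y = σ (y, z) := by
    intro y z
    rw [← Finset.sum_div, ← Finset.sum_mul, hπs]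
    by_cases h : s y = 0
    · rw [hσ0 y z h, mul_zero, zero_div]
    · rw [mul_div_cancel_left₀ _ h]
  have hr1 : ∑ x, r x = 1 := by
    simp_rw [← hπr]
    rw [← Fintype.sum_prod_type, hπ.2]
  refine ⟨fun a => ∑ y, π (a.1, y) * σ (y, a.2) / s y,
    isCoupling_of_marginals (fun a => Finset.sum_nonneg fun y _ => hT0 _ _ _) hr1 (fun x => ?_)
      (fun z => ?_), fun i => le_trans ?_ (add_le_add (hv i) (hw i))⟩
  · rw [Finset.sum_comm]
    simp_rw [hTz, hπr]
  · rw [Finset.sum_comm]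
    simp_rw [hTx, hσt]
  · have e1 : probNe π i = ∑ x, ∑ z, ∑ y, if x i ≠ y i then π (x, y) * σ (y, z) / s y else 0 := by
      rw [probNe_eq]
      refine Finset.sum_congr rfl fun x _ => ?_
      rw [Finset.sum_comm]
      refine Finset.sum_congr rfl fun y _ => ?_
      split_ifs
      · exact (hTz x y).symm
      · simp
    have e2 : probNe σ i = ∑ x, ∑ z, ∑ y, if y i ≠ z i then π (x, y) * σ (y, z) / s y else 0 := by
      rw [probNe_eq, Finset.sum_comm]
      conv_rhs => rw [Finset.sum_comm]
      refine Finset.sum_congr rfl fun z _ => ?_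
      rw [Finset.sum_comm]
      refine Finset.sum_congr rfl fun y _ => ?_
      split_ifs
      · exact (hTx y z).symm
      · simp
    rw [e1, e2, probNe_eq, ← Finset.sum_add_distrib]
    refine Finset.sum_le_sum fun x _ => ?_
    rw [← Finset.sum_add_distrib]
    refine Finset.sum_le_sum fun z _ => ?_
    rw [← Finset.sum_add_distrib]
    split_ifs with h
    · refine Finset.sum_le_sum fun y _ => ?_
      have := hT0 x y z
      by_cases h1 : x i = y i
      · rw [if_neg (not_not.2 h1), if_pos (h1 ▸ h), zero_add]
      · rw [if_pos h1]
        split_ifs <;> linarith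
    · refine Finset.sum_nonneg fun y _ => ?_
      have := hT0 x y z
      split_ifs <;> linarith

/-- Mixtures of couplings are couplings of the mixtures. Components of weight zero are not required
to be coupled, since they may be conditional laws given a null event. -/
theorem CoupledWithin.mix {κ : Type*} (K : Finset κ) (c : κ → ℝ) (hc : ∀ k ∈ K, 0 ≤ c k)
    (hc1 : ∑ k ∈ K, c k = 1) (r s : κ → (ι → X) → ℝ) (v : κ → ι → ℝ)
    (h : ∀ k ∈ K, c k ≠ 0 → CoupledWithin (r k) (s k) (v k)) :
    CoupledWithin (fun x => ∑ k ∈ K, c k * r k x) (fun x => ∑ k ∈ K, c k * s k x)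
      fun i => ∑ k ∈ K, c k * v k i := by
  have h' : ∀ k, ∃ π, k ∈ K → c k ≠ 0 → IsCoupling π (r k) (s k) ∧ ∀ i, probNe π i ≤ v k i := by
    intro k
    by_cases hk : k ∈ K ∧ c k ≠ 0
    · obtain ⟨π, hπ⟩ := h k hk.1 hk.2
      exact ⟨π, fun _ _ => hπ⟩
    · exact ⟨0, fun h1 h2 => (hk ⟨h1, h2⟩).elim⟩
  choose π hπ using h'
  refine ⟨fun a => ∑ k ∈ K, c k * π k a, ⟨⟨fun a => Finset.sum_nonneg fun k hk => ?_, ?_⟩,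
    fun x => ?_, fun y => ?_⟩, fun i => ?_⟩
  · by_cases h0 : c k = 0
    · rw [h0, zero_mul]
    · exact mul_nonneg (hc k hk) ((hπ k hk h0).1.1.1 a)
  · rw [Finset.sum_comm, ← hc1]
    refine Finset.sum_congr rfl fun k hk => ?_
    rw [← Finset.mul_sum]
    by_cases h0 : c k = 0
    · rw [h0, zero_mul]
    · rw [(hπ k hk h0).1.1.2, mul_one]
  · rw [Finset.sum_comm]
    refine Finset.sum_congr rfl fun k hk => ?_
    rw [← Finset.mul_sum]
    by_cases h0 : c k = 0
    · rw [h0, zero_mul, zero_mul]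
    · rw [(hπ k hk h0).1.2.1]
  · rw [Finset.sum_comm]
    refine Finset.sum_congr rfl fun k hk => ?_
    rw [← Finset.mul_sum]
    by_cases h0 : c k = 0
    · rw [h0, zero_mul, zero_mul]
    · rw [(hπ k hk h0).1.2.2]
  · rw [probNe, Finset.sum_comm]
    refine Finset.sum_le_sum fun k hk => ?_
    rw [← Finset.mul_sum]
    by_cases h0 : c k = 0
    · rw [h0, zero_mul, zero_mul]
    · exact mul_le_mul_of_nonneg_left ((hπ k hk h0).2 i) (hc k hk)

/-- Two coupled laws may be mapped by two different maps. The images are coupled by the image of the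
coupling. -/
theorem CoupledWithin.map {κ : Type*} [Fintype κ] [DecidableEq κ] (h : CoupledWithin r s v)
    (F G : (ι → X) → (κ → X)) (w : κ → ℝ)
    (hw : ∀ π, IsCoupling π r s → (∀ i, probNe π i ≤ v i) → ∀ j,
      (∑ x, ∑ y, if F x j ≠ G y j then π (x, y) else 0) ≤ w j) :
    CoupledWithin (push F r) (push G s) w := by
  obtain ⟨π, hπ, hv⟩ := h
  have hr1 : ∑ x, r x = 1 := by
    simp_rw [← hπ.2.1]
    rw [← Fintype.sum_prod_type, hπ.1.2]
  refine ⟨fun a => ∑ x, ∑ y, if F x = a.1 ∧ G y = a.2 then π (x, y) else 0,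
    isCoupling_of_marginals (fun a => Finset.sum_nonneg fun x _ => Finset.sum_nonneg fun y _ => ?_)
      ((sum_push F r).trans hr1) (fun a => ?_) (fun b => ?_), fun j => ?_⟩
  · split_ifs
    · exact hπ.1.1 _
    · rfl
  · rw [Finset.sum_comm, push, Finset.sum_filter]
    refine Finset.sum_congr rfl fun x _ => ?_
    rw [Finset.sum_comm]
    split_ifs with h
    · rw [← hπ.2.1]
      refine Finset.sum_congr rfl fun y _ => ?_
      simp [h]
    · simp [h]
  · rw [Finset.sum_comm, push, Finset.sum_filter]
    simp_rw [Finset.sum_comm (s := (Finset.univ : Finset (κ → X)))]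
    rw [Finset.sum_comm]
    refine Finset.sum_congr rfl fun y _ => ?_
    split_ifs with h
    · rw [← hπ.2.2]
      refine Finset.sum_congr rfl fun x _ => ?_
      simp [h]
    · simp [h]
  · refine le_trans (le_of_eq ?_) (hw π hπ hv j)
    rw [probNe, Finset.sum_comm]
    refine Finset.sum_congr rfl fun x _ => ?_
    rw [Finset.sum_comm]
    refine Finset.sum_congr rfl fun y _ => ?_
    have : ∀ a : (κ → X) × (κ → X), (F x = a.1 ∧ G y = a.2) ↔ (F x, G y) = a := fun a => by
      rw [Prod.ext_iff]
    simp_rw [this]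
    rw [Finset.sum_ite_eq]
    simp

/-- Two laws are coupled within the variational distances of the images under successively coarser
observables: the coordinate `i` is determined by the observable of index `lvl i`. -/
theorem coupledWithin_levels {β : ℕ → Type*} [∀ n, Fintype (β n)] [∀ n, DecidableEq (β n)]
    (f : ∀ n, (ι → X) → β n) (hf : ∀ i j, i ≤ j → ∀ x y, f i x = f i y → f j x = f j y)
    (hr : r ∈ stdSimplex ℝ (ι → X)) (hs : s ∈ stdSimplex ℝ (ι → X)) (lvl : ι → ℕ)
    (hlvl : ∀ i x y, f (lvl i) x = f (lvl i) y → x i = y i) :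
    CoupledWithin r s fun i => varDist (push (f (lvl i)) r) (push (f (lvl i)) s) := by
  obtain ⟨π, h0, h1, h2, h3⟩ := exists_coupling_levels f hf (Finset.univ.sup lvl + 1) 0 r s hr.1
    hs.1 (hr.2.trans hs.2.symm)
  refine ⟨π, isCoupling_of_marginals h0 hr.2 h1 h2, fun i => ?_⟩
  refine le_trans ?_ (sum_sub_sum_min_le_varDist _ _)
  have h4 := h3 (lvl i) (Nat.zero_le _)
    (by have := Finset.le_sup (f := lvl) (Finset.mem_univ i); omega)
  rw [sum_push, hr.2]
  refine le_trans ?_ (sub_le_sub_left h4 1)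
  have h5 : (1 : ℝ) = ∑ x, ∑ y, π (x, y) := by simp_rw [h1, hr.2]
  rw [h5, probNe_eq, ← Finset.sum_sub_distrib]
  refine Finset.sum_le_sum fun x _ => ?_
  rw [← Finset.sum_sub_distrib]
  refine Finset.sum_le_sum fun y _ => ?_
  have := h0 (x, y)
  by_cases h : f (lvl i) x = f (lvl i) y
  · simp [h, hlvl i x y h]
  · rw [if_neg h]
    split_ifs <;> linarith

/-- The maximal coupling. -/
theorem coupledWithin_varDist (hr : r ∈ stdSimplex ℝ (ι → X)) (hs : s ∈ stdSimplex ℝ (ι → X)) :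
    CoupledWithin r s fun _ => varDist r s := by
  have hid : ∀ t : (ι → X) → ℝ, push (fun x => x) t = t := fun t => by
    ext b
    simp [push, Finset.filter_eq']
  simpa only [hid] using coupledWithin_levels (β := fun _ => ι → X) (fun _ x => x)
    (fun _ _ _ _ _ h => h) hr hs (fun _ => 0) (fun i x y h => congrFun h i)

theorem CoupledWithin.W2_le (h : CoupledWithin r s v) : W2 r s ≤ √(∑ i, v i ^ 2) := by
  obtain ⟨π, hπ, h⟩ := h
  have hbdd : BddBelow {c | ∃ π, IsCoupling π r s ∧ c = √(∑ i, probNe π i ^ 2)} := by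
    refine ⟨0, ?_⟩
    rintro c ⟨π, -, rfl⟩
    exact Real.sqrt_nonneg _
  refine (csInf_le hbdd ⟨π, hπ, rfl⟩).trans (Real.sqrt_le_sqrt (Finset.sum_le_sum fun i _ => ?_))
  exact pow_le_pow_left₀ (probNe_nonneg hπ.1.1 i) (h i) 2

theorem W2_nonneg (r s : (ι → X) → ℝ) : 0 ≤ W2 r s := by
  refine Real.sInf_nonneg ?_
  rintro c ⟨π, -, rfl⟩
  exact Real.sqrt_nonneg _

/-- By compactness of the set of couplings, the infimum in the definition of `W2` is attained. -/
theorem exists_coupling_W2 (hr : r ∈ stdSimplex ℝ (ι → X)) (hs : s ∈ stdSimplex ℝ (ι → X)) :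
    ∃ π, IsCoupling π r s ∧ ∑ i, probNe π i ^ 2 = W2 r s ^ 2 := by
  set S : Set ((ι → X) × (ι → X) → ℝ) := {π | IsCoupling π r s} with hS
  have hcont : Continuous fun π : (ι → X) × (ι → X) → ℝ => √(∑ i, probNe π i ^ 2) := by
    unfold probNe
    fun_prop
  have hcomp : IsCompact S := by
    refine (isCompact_stdSimplex ℝ ((ι → X) × (ι → X))).of_isClosed_subset ?_ fun π hπ => hπ.1
    have : S = stdSimplex ℝ ((ι → X) × (ι → X)) ∩
        ((⋂ a, {π | ∑ b, π (a, b) = r a}) ∩ ⋂ b, {π | ∑ a, π (a, b) = s b}) := by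
      ext π
      simp only [hS, IsCoupling, Set.mem_ofPred_eq, Set.mem_inter_iff, Set.mem_iInter]
    rw [this]
    refine (isClosed_stdSimplex ℝ _).inter ((isClosed_iInter fun a => ?_).inter
      (isClosed_iInter fun b => ?_))
    · exact isClosed_eq (by fun_prop) continuous_const
    · exact isClosed_eq (by fun_prop) continuous_const
  obtain ⟨π₀, hπ₀, -⟩ := coupledWithin_varDist hr hs
  have hne : ((fun π => √(∑ i, probNe π i ^ 2)) '' S).Nonempty := ⟨_, π₀, hπ₀, rfl⟩
  obtain ⟨π, hπ, h⟩ := (hcomp.image hcont).sInf_mem hne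
  refine ⟨π, hπ, ?_⟩
  have hset : {c | ∃ π, IsCoupling π r s ∧ c = √(∑ i, probNe π i ^ 2)} =
      (fun π => √(∑ i, probNe π i ^ 2)) '' S := by
    ext c
    simp [hS, eq_comm]
  rw [W2, hset, ← h, Real.sq_sqrt (Finset.sum_nonneg fun i _ => sq_nonneg _)]

theorem W2_sq_le_card_mul_varDist_sq (hr : r ∈ stdSimplex ℝ (ι → X))
    (hs : s ∈ stdSimplex ℝ (ι → X)) : W2 r s ^ 2 ≤ Fintype.card ι * varDist r s ^ 2 := by
  have h := (coupledWithin_varDist hr hs).W2_le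
  have h' := pow_le_pow_left₀ (W2_nonneg r s) h 2
  rwa [Real.sq_sqrt (Finset.sum_nonneg fun i _ => sq_nonneg _), Finset.sum_const,
    Finset.card_univ, nsmul_eq_mul] at h'

end Couplings

/-! ### Lattice distance -/

section Distance

variable {d : ℕ}

theorem rho_le_iff {k i : Site d} {R : ℕ} : rho k i ≤ R ↔ ∀ ν, (k ν - i ν).natAbs ≤ R := by
  simp [rho]

theorem natAbs_sub_le_rho (k i : Site d) (ν : Fin d) : (k ν - i ν).natAbs ≤ rho k i :=
  rho_le_iff.1 le_rfl ν

theorem rho_comm (k i : Site d) : rho k i = rho i k := by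
  unfold rho
  congr 1
  ext ν
  omega

theorem rho_zero_sub (k i : Site d) : rho 0 (k - i) = rho k i := by
  unfold rho
  congr 1
  ext ν
  simp only [Pi.zero_apply, Pi.sub_apply]
  omega

end Distance

/-! ### Counting cubes -/

section Cubes

variable {d m : ℕ}

theorem mem_cube {a i : Site d} : i ∈ cube m a ↔ ∀ ν, a ν ≤ i ν ∧ i ν < a ν + m := by
  simp [cube]

theorem card_cube (a : Site d) : (cube m a).card = m ^ d := by
  simp [cube]

theorem cube_injective (hm : 1 ≤ m) : Function.Injective (cube m : Site d → _) := by
  intro a b hab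
  have h1 : a ∈ cube m b := hab ▸ mem_cube.2 fun ν => by omega
  have h2 : b ∈ cube m a := hab ▸ mem_cube.2 fun ν => by omega
  rw [mem_cube] at h1 h2
  ext ν
  have := h1 ν
  have := h2 ν
  omega

theorem mem_cubes {Λ I : Finset (Site d)} :
    I ∈ cubes m Λ ↔ (∃ a, I = cube m a) ∧ (I ∩ Λ).Nonempty := by
  simp [cubes]

theorem card_inter_le_of_mem_cubes {Λ I : Finset (Site d)} (hI : I ∈ cubes m Λ) :
    (I ∩ Λ).card ≤ m ^ d := by
  obtain ⟨⟨a, rfl⟩, -⟩ := mem_cubes.1 hI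
  exact (Finset.card_le_card Finset.inter_subset_left).trans (card_cube a).le

/-- The lowest corners of the `m`-sided cubes that contain `i`. -/
noncomputable def corners (m : ℕ) (i : Site d) : Finset (Site d) :=
  Fintype.piFinset fun ν => Finset.Ioc (i ν - m) (i ν)

theorem mem_corners {a i : Site d} : a ∈ corners m i ↔ i ∈ cube m a := by
  simp only [corners, Fintype.mem_piFinset, Finset.mem_Ioc, mem_cube]
  refine forall_congr' fun ν => ?_
  omega

theorem filter_mem_cubes {Λ : Finset (Site d)} {i : Site d} (hi : i ∈ Λ) :
    (cubes m Λ).filter (fun I => i ∈ I) = (corners m i).image (cube m) := by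
  ext I
  rw [Finset.mem_filter, mem_cubes, Finset.mem_image]
  constructor
  · rintro ⟨⟨⟨a, rfl⟩, -⟩, hI⟩
    exact ⟨a, mem_corners.2 hI, rfl⟩
  · rintro ⟨a, ha, rfl⟩
    exact ⟨⟨⟨a, rfl⟩, i, Finset.mem_inter.2 ⟨mem_corners.1 ha, hi⟩⟩, mem_corners.1 ha⟩

theorem card_filter_mem_cubes (hm : 1 ≤ m) {Λ : Finset (Site d)} {i : Site d} (hi : i ∈ Λ) :
    ((cubes m Λ).filter fun I => i ∈ I).card = m ^ d := by
  rw [filter_mem_cubes hi, Finset.card_image_of_injective _ (cube_injective hm)]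
  simp [corners]

/-- The number of cubes containing `i` that do not contain `k` but come within distance `R` of `k`.
Such a cube misses `k` in some direction `ν`, which leaves only `R` positions along `ν`. -/
theorem card_filter_cubes_separating_le (Λ : Finset (Site d)) (i k : Site d) (R : ℕ) :
    ((cubes m Λ).filter fun I => i ∈ I ∧ k ∉ I ∧ ∃ j ∈ I, rho k j ≤ R).card ≤
      d * (R * m ^ (d - 1)) := by
  classical
  -- The positions along `ν`; the first case is that of cubes above `k`, the second below `k`.
  let bad : Fin d → Finset ℤ := fun ν =>
    if k ν < i ν then Finset.Ioc (k ν) (k ν + R) else Finset.Ioc (k ν - m - R) (k ν - m)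
  have hbad : ∀ ν, (bad ν).card = R := fun ν => by
    dsimp only [bad]
    split_ifs <;> simp
  let T : Fin d → Finset (Site d) := fun ν => Fintype.piFinset fun μ =>
    if μ = ν then bad ν else Finset.Ioc (i μ - m) (i μ)
  have hT : ∀ ν, (T ν).card = R * m ^ (d - 1) := by
    intro ν
    rw [Fintype.card_piFinset, ← Finset.mul_prod_erase _ _ (Finset.mem_univ ν)]
    rw [if_pos rfl, hbad]
    congr 1
    rw [Finset.prod_congr rfl (g := fun _ => m), Finset.prod_const, Finset.card_erase_of_mem
      (Finset.mem_univ ν), Finset.card_univ, Fintype.card_fin]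
    intro μ hμ
    rw [if_neg (Finset.ne_of_mem_erase hμ)]
    simp
  have hsub : ((cubes m Λ).filter fun I => i ∈ I ∧ k ∉ I ∧ ∃ j ∈ I, rho k j ≤ R) ⊆
      (Finset.univ.biUnion T).image (cube m) := by
    intro I hI
    obtain ⟨hI, hiI, hkI, j, hjI, hj⟩ := Finset.mem_filter.1 hI
    obtain ⟨⟨a, rfl⟩, -⟩ := mem_cubes.1 hI
    refine Finset.mem_image.2 ⟨a, ?_, rfl⟩
    rw [mem_cube] at hiI hkI hjI
    obtain ⟨ν, hν⟩ := not_forall.1 hkI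
    refine Finset.mem_biUnion.2 ⟨ν, Finset.mem_univ _, Fintype.mem_piFinset.2 fun μ => ?_⟩
    split_ifs with h
    · subst h
      have h1 := hiI μ
      have h2 := hjI μ
      have h3 := rho_le_iff.1 hj μ
      dsimp only [bad]
      split_ifs <;> rw [Finset.mem_Ioc] <;> omega
    · have := hiI μ
      rw [Finset.mem_Ioc]
      omega
  calc _ ≤ ((Finset.univ.biUnion T).image (cube m)).card := Finset.card_le_card hsub
    _ ≤ (Finset.univ.biUnion T).card := Finset.card_image_le
    _ ≤ ∑ ν, (T ν).card := Finset.card_biUnion_le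
    _ = d * (R * m ^ (d - 1)) := by simp [hT]

end Cubes

/-! ### Sums of the coupling function over shells -/

section Shells

variable {d : ℕ} {φ : ℕ → ℝ}

/-- The sites with coordinate `c` in the direction `ν` and the others in `[-r, r]`. For `c = ± r`
these are the faces of the cubical shell of radius `r`. -/
noncomputable def face (ν : Fin d) (c : ℤ) (r : ℕ) : Finset (Site d) :=
  Fintype.piFinset fun μ => if μ = ν then {c} else Finset.Icc (-(r : ℤ)) r

theorem card_face (ν : Fin d) (c : ℤ) (r : ℕ) : (face ν c r).card = (2 * r + 1) ^ (d - 1) := by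
  rw [face, Fintype.card_piFinset, ← Finset.mul_prod_erase _ _ (Finset.mem_univ ν), if_pos rfl,
    Finset.card_singleton, one_mul, Finset.prod_congr rfl (g := fun _ => 2 * r + 1),
    Finset.prod_const, Finset.card_erase_of_mem (Finset.mem_univ ν), Finset.card_univ,
    Fintype.card_fin]
  intro μ hμ
  rw [if_neg (Finset.ne_of_mem_erase hμ), Int.card_Icc]
  omega

theorem rho_zero_of_mem_face {ν : Fin d} {r : ℕ} {i : Site d} (hi : i ∈ face ν r r) :
    rho 0 i = r := by
  rw [face, Fintype.mem_piFinset] at hi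
  refine le_antisymm (rho_le_iff.2 fun μ => ?_) ?_
  · have := hi μ
    split_ifs at this
    · rw [Finset.mem_singleton] at this
      simp [this]
    · rw [Finset.mem_Icc] at this
      simp only [Pi.zero_apply]
      omega
  · have := hi ν
    rw [if_pos rfl, Finset.mem_singleton] at this
    have h2 := natAbs_sub_le_rho 0 i ν
    simpa [this] using h2

/-- The shell of radius `r` is covered by its `2 d` faces. -/
theorem card_shell_le (hd : 1 ≤ d) (S : Finset (Site d)) (r : ℕ) :
    (S.filter fun i => rho 0 i = r).card ≤ 2 * d * (2 * r + 1) ^ (d - 1) := by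
  have hsub : (S.filter fun i => rho 0 i = r) ⊆
      Finset.univ.biUnion fun ν => face ν (r : ℤ) r ∪ face ν (-(r : ℤ)) r := by
    intro i hi
    have hi := (Finset.mem_filter.1 hi).2
    have hne : (Finset.univ : Finset (Fin d)).Nonempty := ⟨⟨0, hd⟩, Finset.mem_univ _⟩
    obtain ⟨ν, -, hν⟩ := Finset.exists_mem_eq_sup _ hne fun ν => ((0 : Site d) ν - i ν).natAbs
    have hν : ((0 : Site d) ν - i ν).natAbs = r := hν.symm.trans hi
    have hmem : ∀ c : ℤ, i ν = c → i ∈ face ν c r := by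
      intro c hc
      refine Fintype.mem_piFinset.2 fun μ => ?_
      split_ifs with h
      · subst h
        simpa using hc
      · have := rho_le_iff.1 hi.le μ
        simp only [Pi.zero_apply] at this
        rw [Finset.mem_Icc]
        omega
    refine Finset.mem_biUnion.2 ⟨ν, Finset.mem_univ _, Finset.mem_union.2 ?_⟩
    simp only [Pi.zero_apply] at hν
    rcases le_total 0 (i ν) with h | h
    · exact Or.inl (hmem _ (by omega))
    · exact Or.inr (hmem _ (by omega))
  calc _ ≤ _ := Finset.card_le_card hsub
    _ ≤ ∑ ν : Fin d, (face ν (r : ℤ) r ∪ face ν (-(r : ℤ)) r).card := Finset.card_biUnion_le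
    _ ≤ ∑ _ν : Fin d, 2 * (2 * r + 1) ^ (d - 1) := Finset.sum_le_sum fun ν _ => by
      refine (Finset.card_union_le _ _).trans (le_of_eq ?_)
      rw [card_face, card_face]
      ring
    _ = 2 * d * (2 * r + 1) ^ (d - 1) := by
      rw [Finset.sum_const, Finset.card_univ, Fintype.card_fin, smul_eq_mul]
      ring

theorem summable_shells (hd : 1 ≤ d) (hφ : IsCouplingFunction d φ) :
    Summable fun r : ℕ => (2 * (r : ℝ) + 1) ^ (d - 1) * φ r := by
  refine summable_of_sum_range_le (c := ∑' i : Site d, φ (rho 0 i))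
    (fun r => mul_nonneg (by positivity) (hφ.nonneg r)) fun n => ?_
  -- One face of each shell already has `(2 r + 1) ^ (d - 1)` sites.
  have hdisj : Set.PairwiseDisjoint (↑(Finset.range n))
      fun r : ℕ => face (⟨0, hd⟩ : Fin d) (r : ℤ) r := by
    intro r _ r' _ hrr'
    refine Finset.disjoint_left.2 fun i hi hi' => hrr' ?_
    rw [← rho_zero_of_mem_face hi, ← rho_zero_of_mem_face hi']
  refine le_trans (le_of_eq ?_) (hφ.summable.sum_le_tsum
    ((Finset.range n).biUnion fun r => face (⟨0, hd⟩ : Fin d) (r : ℤ) r) fun i _ => hφ.nonneg _)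
  rw [Finset.sum_biUnion hdisj]
  refine Finset.sum_congr rfl fun r _ => ?_
  rw [Finset.sum_congr rfl fun i hi => by rw [rho_zero_of_mem_face hi], Finset.sum_const,
    card_face, nsmul_eq_mul]
  push_cast
  rfl

/-- The series on the right converges by `summable_shells`, so that its `tsum` is an actual sum. -/
theorem sum_far_le (hd : 1 ≤ d) (hφ : IsCouplingFunction d φ) (S : Finset (Site d)) (R : ℕ) :
    ∑ i ∈ S with R ≤ rho 0 i, φ (rho 0 i) ≤
      2 * d * ∑' j : ℕ, (2 * ((R + j : ℕ) : ℝ) + 1) ^ (d - 1) * φ (R + j) := by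
  set T := S.filter fun i => R ≤ rho 0 i
  set n := T.sup (rho 0) + 1
  have hsum : Summable fun j : ℕ => (2 * ((R + j : ℕ) : ℝ) + 1) ^ (d - 1) * φ (R + j) := by
    have := (summable_nat_add_iff R).2 (summable_shells hd hφ)
    simpa only [add_comm R] using this
  have hmaps : ∀ i ∈ T, rho 0 i - R ∈ Finset.range n := by
    intro i hi
    have := Finset.le_sup (f := rho 0) hi
    rw [Finset.mem_range]
    omega
  rw [← Finset.sum_fiberwise_of_maps_to hmaps, ← tsum_mul_left]
  refine le_trans (Finset.sum_le_sum fun j _ => ?_)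
    ((hsum.mul_left _).sum_le_tsum (Finset.range n) fun j _ => ?_)
  · have h1 : (T.filter fun i => rho 0 i - R = j) = T.filter fun i => rho 0 i = R + j := by
      refine Finset.filter_congr fun i hi => ?_
      have := (Finset.mem_filter.1 hi).2
      omega
    rw [h1, Finset.sum_congr rfl fun i hi => by rw [(Finset.mem_filter.1 hi).2],
      Finset.sum_const, nsmul_eq_mul, ← mul_assoc]
    refine mul_le_mul_of_nonneg_right ?_ (hφ.nonneg _)
    exact_mod_cast card_shell_le hd T (R + j)
  · have := hφ.nonneg (R + j)
    positivity

/-- Sums over `k` of a function of `ρ(k, i)` are sums of a function of `ρ(0, ·)`. -/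
theorem sum_rho_eq (S : Finset (Site d)) (i : Site d) (g : ℕ → ℝ) :
    ∑ k ∈ S, g (rho k i) = ∑ k ∈ S.image (fun k => k - i), g (rho 0 k) := by
  rw [Finset.sum_image fun a _ b _ h => sub_left_injective h]
  simp_rw [rho_zero_sub]

theorem sum_rho_le_normPhi (hφ : IsCouplingFunction d φ) (S : Finset (Site d)) (i : Site d) :
    ∑ k ∈ S, φ (rho k i) ≤ normPhi d φ := by
  rw [sum_rho_eq]
  exact hφ.summable.sum_le_tsum _ fun k _ => hφ.nonneg _

theorem normPhi_nonneg (hφ : IsCouplingFunction d φ) : 0 ≤ normPhi d φ :=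
  tsum_nonneg fun _ => hφ.nonneg _

/-- The proportion `min 1 (d ρ / m)` is replaced by `d R / m` at distances `ρ < R` and by `1` at the
others. -/
theorem sum_min_mul_le (hd : 1 ≤ d) (hφ : IsCouplingFunction d φ) (m : ℕ) (S : Finset (Site d))
    (i : Site d) (R : ℕ) :
    ∑ k ∈ S, min 1 ((d : ℝ) * rho k i / m) * φ (rho k i) ≤
      normPhi d φ * ((d : ℝ) * R / m) +
        2 * d * ∑' j : ℕ, (2 * ((R + j : ℕ) : ℝ) + 1) ^ (d - 1) * φ (R + j) := by
  have h1 : ∀ k ∈ S, min 1 ((d : ℝ) * rho k i / m) * φ (rho k i) ≤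
      φ (rho k i) * ((d : ℝ) * R / m) + if R ≤ rho k i then φ (rho k i) else 0 := by
    intro k _
    have h0 := hφ.nonneg (rho k i)
    split_ifs with h
    · have h2 : min 1 ((d : ℝ) * rho k i / m) * φ (rho k i) ≤ 1 * φ (rho k i) :=
        mul_le_mul_of_nonneg_right (min_le_left _ _) h0
      have h3 : 0 ≤ φ (rho k i) * ((d : ℝ) * R / m) := by positivity
      linarith
    · rw [add_zero, mul_comm]
      refine mul_le_mul_of_nonneg_left ((min_le_right _ _).trans ?_) h0
      have : (rho k i : ℝ) ≤ R := by exact_mod_cast (not_le.1 h).le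
      gcongr
  refine (Finset.sum_le_sum h1).trans ?_
  rw [Finset.sum_add_distrib, ← Finset.sum_mul]
  refine add_le_add (mul_le_mul_of_nonneg_right (sum_rho_le_normPhi hφ S i) (by positivity)) ?_
  rw [sum_rho_eq S i fun r => if R ≤ r then φ r else 0, ← Finset.sum_filter]
  exact sum_far_le hd hφ _ R

theorem sum_min_mul_le_Theta (hd : 1 ≤ d) (hφ : IsCouplingFunction d φ) (m : ℕ)
    (S : Finset (Site d)) (i : Site d) :
    ∑ k ∈ S, min 1 ((d : ℝ) * rho k i / m) * φ (rho k i) ≤ Theta d φ m :=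
  le_ciInf fun R => sum_min_mul_le hd hφ m S i R

theorem Theta_nonneg (hφ : IsCouplingFunction d φ) (m : ℕ) : 0 ≤ Theta d φ m := by
  refine Real.iInf_nonneg fun R => add_nonneg (mul_nonneg (normPhi_nonneg hφ) (by positivity))
    (mul_nonneg (by positivity) (tsum_nonneg fun j => mul_nonneg (by positivity) (hφ.nonneg _)))

end Shells

/-! ### Resampling part of a configuration -/

section Resampling

variable {d : ℕ} {X : Type*} {Λ J : Finset (Site d)}

/-- The configuration on `Λ` equal to `u` on `J` and to `y` off `J`. -/
def patch (J : Finset (Site d)) (y : Λ → X) (u : J → X) : Λ → X :=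
  fun i => if h : (i : Site d) ∈ J then u ⟨i, h⟩ else y i

theorem patch_of_mem (y : Λ → X) (u : J → X) {i : Λ} (h : (i : Site d) ∈ J) :
    patch J y u i = u ⟨i, h⟩ :=
  dif_pos h

theorem patch_of_notMem (y : Λ → X) (u : J → X) {i : Λ} (h : (i : Site d) ∉ J) :
    patch J y u i = y i :=
  dif_neg h

theorem join_of_mem (y : Λ → X) (η : {i // i ∉ Λ} → X) {i : Site d} (h : i ∈ Λ) :
    join Λ y η i = y ⟨i, h⟩ :=
  dif_pos h

theorem restrict_join (y : Λ → X) (η : {i // i ∉ Λ} → X) : Λ.restrict (join Λ y η) = y := by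
  ext i
  exact join_of_mem y η i.2

theorem outside_join (y : Λ → X) (η : {i // i ∉ Λ} → X) : outside Λ (join Λ y η) = η := by
  ext i
  exact dif_neg i.2

theorem restrict_join_join (y : Λ → X) (η : {i // i ∉ Λ} → X) (u : J → X) :
    Λ.restrict (join J u (outside J (join Λ y η))) = patch J y u := by
  ext i
  by_cases h : (i : Site d) ∈ J
  · rw [patch_of_mem y u h]
    exact dif_pos h
  · rw [patch_of_notMem y u h]
    exact (dif_neg h).trans (join_of_mem y η i.2)

theorem outside_join_patch (y : Λ → X) (η : {i // i ∉ Λ} → X) (u : J → X) :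
    outside J (join Λ (patch J y u) η) = outside J (join Λ y η) := by
  ext i
  simp only [outside, join]
  split_ifs
  · exact patch_of_notMem y u i.2
  · rfl

theorem patch_eq_iff (hJ : J ⊆ Λ) (y w : Λ → X) (u : J → X) :
    patch J y u = w ↔ Finset.restrict₂ (π := fun _ => X) hJ w = u ∧
      patch J w (Finset.restrict₂ (π := fun _ => X) hJ y) = y := by
  constructor
  · rintro rfl
    refine ⟨?_, ?_⟩
    · ext j
      exact patch_of_mem (i := ⟨j, hJ j.2⟩) y u j.2
    · ext i
      by_cases h : (i : Site d) ∈ J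
      · rw [patch_of_mem _ _ h]
        rfl
      · rw [patch_of_notMem _ _ h, patch_of_notMem _ _ h]
  · rintro ⟨rfl, h⟩
    ext i
    by_cases hi : (i : Site d) ∈ J
    · rw [patch_of_mem _ _ hi]
      rfl
    · rw [patch_of_notMem _ _ hi, ← h, patch_of_notMem _ _ hi]

theorem patch_patch (y : Λ → X) (u u' : J → X) : patch J (patch J y u) u' = patch J y u' := by
  ext i
  by_cases h : (i : Site d) ∈ J
  · rw [patch_of_mem _ _ h, patch_of_mem _ _ h]
  · rw [patch_of_notMem _ _ h, patch_of_notMem _ _ h, patch_of_notMem _ _ h]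

theorem patch_restrict (hJ : J ⊆ Λ) (y : Λ → X) :
    patch J y (Finset.restrict₂ (π := fun _ => X) hJ y) = y := by
  ext i
  by_cases h : (i : Site d) ∈ J
  · rw [patch_of_mem _ _ h]
    rfl
  · rw [patch_of_notMem _ _ h]

variable [Fintype X]

theorem condLaw_join (p : (Λ → X) → ℝ) (y : Λ → X) (η : {i // i ∉ Λ} → X) (u : J → X) :
    condLaw p J (join Λ y η) u = p (patch J y u) / ∑ u', p (patch J y u') := by
  simp_rw [condLaw, restrict_join_join]

theorem le_sum_patch (hJ : J ⊆ Λ) {p : (Λ → X) → ℝ} (hp : ∀ y, 0 ≤ p y) (y : Λ → X) :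
    p y ≤ ∑ u, p (patch J y u) := by
  conv_lhs => rw [← patch_restrict hJ y]
  exact Finset.single_le_sum (f := fun u => p (patch J y u)) (fun u _ => hp _) (Finset.mem_univ _)

theorem condLaw_mem (hJ : J ⊆ Λ) {p : (Λ → X) → ℝ} (hp : ∀ y, 0 ≤ p y) {y : Λ → X}
    (hy : p y ≠ 0) (η : {i // i ∉ Λ} → X) :
    condLaw p J (join Λ y η) ∈ stdSimplex ℝ (J → X) := by
  have hpos : 0 < ∑ u, p (patch J y u) :=
    ((hp y).lt_of_ne' hy).trans_le (le_sum_patch hJ hp y)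
  refine ⟨fun u => ?_, ?_⟩
  · rw [condLaw_join]
    exact div_nonneg (hp _) hpos.le
  · simp_rw [condLaw_join]
    rw [← Finset.sum_div, div_self hpos.ne']

variable [DecidableEq X]

/-- A law that has the conditional laws `K` on `J` is invariant under resampling `J` by `K`. -/
theorem sum_mul_push_patch (hJ : J ⊆ Λ) (p : (Λ → X) → ℝ) (K : (Λ → X) → (J → X) → ℝ)
    (hK : ∀ y u, K (patch J y u) = K y)
    (hp : ∀ y, p y = (∑ u, p (patch J y u)) * K y (Finset.restrict₂ (π := fun _ => X) hJ y))
    (w : Λ → X) : ∑ y, p y * push (patch J y) (K y) w = p w := by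
  set res : (Λ → X) → (J → X) := Finset.restrict₂ (π := fun _ => X) hJ
  have h1 : ∀ y, p y * push (patch J y) (K y) w =
      if patch J w (res y) = y then p y * K w (res w) else 0 := by
    intro y
    rw [push, Finset.filter_congr fun u _ => patch_eq_iff hJ y w u]
    split_ifs with h
    · simp only [h, and_true, Finset.filter_eq, Finset.mem_univ, if_true, res, Finset.sum_singleton]
      rw [← hK w (res y), h]
    · simp [h, res]
  simp_rw [h1]
  rw [hp w, Finset.sum_mul, ← Finset.sum_filter]
  refine Finset.sum_nbij' (fun y => res y) (fun u => patch J w u) (fun _ _ => Finset.mem_univ _)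
    (fun u _ => ?_) (fun y hy => (Finset.mem_filter.1 hy).2) (fun u _ => ?_) (fun y hy => ?_)
  · rw [Finset.mem_filter]
    exact ⟨Finset.mem_univ _, congrArg (patch J w) ((patch_eq_iff hJ w _ u).1 rfl).1⟩
  · exact ((patch_eq_iff hJ w _ u).1 rfl).1
  · rw [(Finset.mem_filter.1 hy).2]

theorem sum_mul_push_condLaw (hJ : J ⊆ Λ) {p : (Λ → X) → ℝ} (hp : ∀ y, 0 ≤ p y)
    (η : {i // i ∉ Λ} → X) (w : Λ → X) :
    ∑ y, p y * push (patch J y) (condLaw p J (join Λ y η)) w = p w := by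
  refine sum_mul_push_patch hJ p (fun y => condLaw p J (join Λ y η)) (fun y u => ?_)
    (fun y => ?_) w
  · ext u'
    simp_rw [condLaw_join, patch_patch]
  · rw [condLaw_join, patch_restrict]
    by_cases h : ∑ u, p (patch J y u) = 0
    · rw [h, zero_mul]
      exact le_antisymm ((le_sum_patch hJ hp y).trans h.le) (hp y)
    · rw [mul_div_cancel₀ _ h]

theorem sum_mul_push_law (q : Ensemble d X) (hJ : J ⊆ Λ) (η : {i // i ∉ Λ} → X) (w : Λ → X) :
    ∑ y, q.law Λ η y * push (patch J y) (q.law J (outside J (join Λ y η))) w = q.law Λ η w := by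
  refine sum_mul_push_patch hJ (q.law Λ η) (fun y => q.law J (outside J (join Λ y η)))
    (fun y u => by rw [outside_join_patch]) (fun y => ?_) w
  have h := q.compat J Λ hJ (join Λ y η)
  simp_rw [restrict_join_join] at h
  rw [restrict_join, outside_join] at h
  refine h.trans ?_
  congr 2
  ext j
  exact join_of_mem y η (hJ j.2)

theorem CoupledWithin.push_patch {r s : (J → X) → ℝ} {v : J → ℝ} (h : CoupledWithin r s v)
    (y z : Λ → X) :
    CoupledWithin (push (patch J y) r) (push (patch J z) s) fun i =>
      if h : (i : Site d) ∈ J then v ⟨i, h⟩ else if y i ≠ z i then 1 else 0 := by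
  refine h.map _ _ _ fun π hπ hv i => ?_
  split_ifs with hi h'
  · refine le_trans (le_of_eq ?_) (hv ⟨i, hi⟩)
    rw [probNe_eq]
    simp_rw [patch_of_mem _ _ hi]
  · simp_rw [patch_of_notMem _ _ hi, if_pos h']
    rw [← Fintype.sum_prod_type, hπ.1.2]
  · simp_rw [patch_of_notMem _ _ hi, if_neg h']
    simp

/-- If the laws of an ensemble on `J` for boundary conditions that differ only at `k` are coupled
within `D k`, then for general boundary conditions the bounds add up over the sites of
disagreement, which are changed one by one. -/
theorem coupledWithin_of_agree_off (q : Ensemble d X) {D : Site d → Site d → ℝ}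
    (hD : ∀ (k : {i // i ∉ J}) (y z : {i // i ∉ J} → X), (∀ i, i ≠ k → y i = z i) →
      CoupledWithin (q.law J y) (q.law J z) fun i => D k i) (S : Finset (Site d)) :
    ∀ x x' : Site d → X, (∀ i, i ∉ S → x i = x' i) →
      CoupledWithin (q.law J (outside J x)) (q.law J (outside J x'))
        fun i => ∑ k ∈ S, if k ∈ J then 0 else D k i := by
  induction S using Finset.induction_on with
  | empty =>
    intro x x' h
    have : x = x' := funext fun i => h i (Finset.notMem_empty i)
    subst this
    simpa using CoupledWithin.refl (q.law_mem J (outside J x))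
  | insert k S hk ih =>
    intro x x' h
    have h1 := ih x (Function.update x' k (x k)) fun i hi => by
      by_cases hik : i = k
      · subst hik
        simp
      · rw [Function.update_of_ne hik]
        exact h i (by simp [hik, hi])
    have h2 : CoupledWithin (q.law J (outside J (Function.update x' k (x k))))
        (q.law J (outside J x')) fun i => if k ∈ J then 0 else D k i := by
      by_cases hkJ : k ∈ J
      · have : outside J (Function.update x' k (x k)) = outside J x' := by
          ext i
          exact Function.update_of_ne (fun h : (i : Site d) = k => i.2 (h ▸ hkJ)) _ _
        rw [this]
        simpa [hkJ] using CoupledWithin.refl (q.law_mem J (outside J x'))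
      · simp only [hkJ, if_false]
        refine hD ⟨k, hkJ⟩ _ _ fun i hi => ?_
        exact Function.update_of_ne (fun h => hi (Subtype.ext h)) _ _
    refine (h1.trans h2).mono fun i => ?_
    rw [Finset.sum_insert hk, add_comm]

/-- Strong mixing controls all coordinates by a single coupling: the restrictions to the sets
`{j ∈ J | n ≤ ρ(k, j)}` are successively coarser observables. -/
theorem StronglyMixing.coupledWithin {q : Ensemble d X} {φ : ℕ → ℝ} (hq : StronglyMixing q φ)
    (k : {i // i ∉ J}) (y z : {i // i ∉ J} → X) (hyz : ∀ i, i ≠ k → y i = z i) :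
    CoupledWithin (q.law J y) (q.law J z) fun i => φ (rho (k : Site d) (i : Site d)) := by
  let M : ℕ → Finset (Site d) := fun n => J.filter fun j => n ≤ rho (k : Site d) j
  have hMJ : ∀ n, M n ⊆ J := fun n => Finset.filter_subset _ _
  have hmem : ∀ i : J, (i : Site d) ∈ M (rho (k : Site d) i) :=
    fun i => Finset.mem_filter.2 ⟨i.2, le_rfl⟩
  refine (coupledWithin_levels (β := fun n => M n → X)
    (fun n => Finset.restrict₂ (π := fun _ => X) (hMJ n)) (fun a b hab w w' h => ?_)
    (q.law_mem J y) (q.law_mem J z) (fun i : J => rho (k : Site d) i) (fun i w w' h => ?_)).mono fun i => ?_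
  · ext j
    have hj := Finset.mem_filter.1 j.2
    exact congrFun h ⟨j, Finset.mem_filter.2 ⟨hj.1, hab.trans hj.2⟩⟩
  · exact congrFun h ⟨i, hmem i⟩
  · have hne : (M (rho (k : Site d) i)).Nonempty := ⟨i, hmem i⟩
    refine (hq _ J (hMJ (rho (k : Site d) i)) hne k y z hyz).trans (le_of_eq (congrArg φ ?_))
    refine le_antisymm (Finset.inf'_le _ (hmem i)) (Finset.le_inf' _ _ fun j hj => ?_)
    exact (Finset.mem_filter.1 hj).2

/-- Resampling `J` by an ensemble carries a coupling to a coupling: sites off `J` keep their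
disagreement probability, and those in `J` collect the influence of all sites off `J`. -/
theorem coupledWithin_resample (q : Ensemble d X) (η : {i // i ∉ Λ} → X)
    {D : Site d → Site d → ℝ}
    (hD : ∀ (k : {i // i ∉ J}) (y z : {i // i ∉ J} → X), (∀ i, i ≠ k → y i = z i) →
      CoupledWithin (q.law J y) (q.law J z) fun i => D k i)
    {r s : (Λ → X) → ℝ} {π : (Λ → X) × (Λ → X) → ℝ} (hπ : IsCoupling π r s) :
    CoupledWithin
      (fun w => ∑ y, r y * push (patch J y) (q.law J (outside J (join Λ y η))) w)
      (fun w => ∑ y, s y * push (patch J y) (q.law J (outside J (join Λ y η))) w)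
      fun i : Λ => if (i : Site d) ∈ J then
        ∑ k : Λ, (if (k : Site d) ∈ J then 0 else D k i) * probNe π k else probNe π i := by
  have hpair : ∀ a : (Λ → X) × (Λ → X), CoupledWithin
      (push (patch J a.1) (q.law J (outside J (join Λ a.1 η))))
      (push (patch J a.2) (q.law J (outside J (join Λ a.2 η))))
      fun i : Λ => if (i : Site d) ∈ J then
        ∑ k : Λ, (if a.1 k ≠ a.2 k then (if (k : Site d) ∈ J then 0 else D k i) else 0)
        else if a.1 i ≠ a.2 i then 1 else 0 := by
    intro a
    refine ((coupledWithin_of_agree_off q hD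
      ((Finset.univ.filter fun k : Λ => a.1 k ≠ a.2 k).image Subtype.val)
      (join Λ a.1 η) (join Λ a.2 η) fun i hi => ?_).push_patch a.1 a.2).mono fun i => ?_
    · unfold join
      split_ifs with h
      · by_contra hne
        exact hi (Finset.mem_image.2 ⟨⟨i, h⟩, by simpa using hne, rfl⟩)
      · rfl
    · by_cases hi : (i : Site d) ∈ J
      · rw [dif_pos hi, if_pos hi, Finset.sum_image fun _ _ _ _ h => Subtype.ext h,
          Finset.sum_filter]
      · rw [dif_neg hi, if_neg hi]
  have hprob : ∀ k, probNe π k = ∑ a, π a * if a.1 k ≠ a.2 k then 1 else 0 := fun k => by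
    simp [probNe, Finset.sum_filter]
  have h := CoupledWithin.mix Finset.univ π (fun a _ => hπ.1.1 a) hπ.1.2 _ _ _
    fun a _ _ => hpair a
  have e1 : ∀ w, ∑ a, π a * push (patch J a.1) (q.law J (outside J (join Λ a.1 η))) w =
      ∑ y, r y * push (patch J y) (q.law J (outside J (join Λ y η))) w := fun w => by
    rw [Fintype.sum_prod_type]
    simp_rw [← Finset.sum_mul, hπ.2.1]
  have e2 : ∀ w, ∑ a, π a * push (patch J a.2) (q.law J (outside J (join Λ a.2 η))) w =
      ∑ y, s y * push (patch J y) (q.law J (outside J (join Λ y η))) w := fun w => by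
    rw [Fintype.sum_prod_type, Finset.sum_comm]
    simp_rw [← Finset.sum_mul, hπ.2.2]
  simp_rw [e1, e2] at h
  refine h.mono fun i => le_of_eq ?_
  split_ifs with hi
  · simp_rw [hprob, Finset.mul_sum]
    rw [Finset.sum_comm]
    refine Finset.sum_congr rfl fun k _ => Finset.sum_congr rfl fun a _ => ?_
    split_ifs <;> ring
  · exact (hprob i).symm

theorem sq_sum_mul_le {κ : Type*} {K : Finset κ} {c f : κ → ℝ} (hc : ∀ k ∈ K, 0 ≤ c k)
    (hc1 : ∑ k ∈ K, c k = 1) : (∑ k ∈ K, c k * f k) ^ 2 ≤ ∑ k ∈ K, c k * f k ^ 2 := by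
  simpa using (even_two.convexOn_pow (𝕜 := ℝ)).map_sum_le hc hc1 fun k _ => Set.mem_univ (f k)

/-- Resampling `J` by `q` moves `p`, whose own conditional laws leave it invariant, by a distance
controlled by the conditional laws of `p` and `q` on `J`. -/
theorem exists_coupledWithin_resample_self (q : Ensemble d X) (hJ : J ⊆ Λ)
    (η : {i // i ∉ Λ} → X) {p : (Λ → X) → ℝ} (hp : p ∈ stdSimplex ℝ (Λ → X)) :
    ∃ b : Λ → ℝ, CoupledWithin p
        (fun w => ∑ y, p y * push (patch J y) (q.law J (outside J (join Λ y η))) w) b ∧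
      (∀ i : Λ, (i : Site d) ∉ J → b i = 0) ∧
      ∑ i, b i ^ 2 ≤ ∑ y, p y *
        W2 (condLaw p J (join Λ y η)) (q.law J (outside J (join Λ y η))) ^ 2 := by
  -- Where `p y = 0`, `condLaw` need not be a probability vector; such `y` do not contribute.
  have h : ∀ y, ∃ e : J → ℝ, p y ≠ 0 →
      CoupledWithin (condLaw p J (join Λ y η)) (q.law J (outside J (join Λ y η))) e ∧
      ∑ i, e i ^ 2 = W2 (condLaw p J (join Λ y η)) (q.law J (outside J (join Λ y η))) ^ 2 := by
    intro y
    by_cases hy : p y = 0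
    · exact ⟨0, fun h => (h hy).elim⟩
    · obtain ⟨π, hπ, h⟩ := exists_coupling_W2 (condLaw_mem hJ hp.1 hy η)
        (q.law_mem J (outside J (join Λ y η)))
      exact ⟨probNe π, fun _ => ⟨⟨π, hπ, fun _ => le_rfl⟩, h⟩⟩
  choose e he using h
  have hmix := CoupledWithin.mix Finset.univ p (fun y _ => hp.1 y) hp.2 _ _ _
    fun y _ hy => (he y hy).1.push_patch y y
  simp_rw [sum_mul_push_condLaw hJ hp.1 η] at hmix
  refine ⟨_, hmix, fun i hi => ?_, ?_⟩
  · simp [hi]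
  · refine (Finset.sum_le_sum fun i _ => sq_sum_mul_le (fun y _ => hp.1 y) hp.2).trans ?_
    rw [Finset.sum_comm]
    refine Finset.sum_le_sum fun y _ => ?_
    rw [← Finset.mul_sum]
    by_cases hy : p y = 0
    · rw [hy, zero_mul, zero_mul]
    refine mul_le_mul_of_nonneg_left (le_of_eq ?_) (hp.1 y)
    rw [← (he y hy).2]
    simp only [ne_eq, not_true_eq_false, if_false]
    symm
    refine Finset.sum_of_injOn (fun j : J => (⟨j, hJ j.2⟩ : Λ)) ?_ ?_ ?_ ?_
    · intro j _ j' _ h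
      exact Subtype.ext (Subtype.mk.inj h)
    · exact fun _ _ => Finset.mem_univ _
    · intro i _ hi
      have : (i : Site d) ∉ J := fun h => hi ⟨⟨i, h⟩, by simp, rfl⟩
      simp [this]
    · intro j _
      simp

end Resampling

/-! ### Contraction of the Gibbs sampler -/

section Contraction

theorem sqrt_sum_add_sq_le {κ : Type*} [Fintype κ] (b c : κ → ℝ) :
    √(∑ i, (b i + c i) ^ 2) ≤ √(∑ i, b i ^ 2) + √(∑ i, c i ^ 2) := by
  have h := norm_add_le (WithLp.toLp 2 b : EuclideanSpace ℝ κ) (WithLp.toLp 2 c)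
  simpa [EuclideanSpace.norm_eq] using h

theorem sqrt_sum_mul_sq {κ : Type*} [Fintype κ] {t : ℝ} (ht : 0 ≤ t) (c : κ → ℝ) :
    √(∑ i, (t * c i) ^ 2) = t * √(∑ i, c i ^ 2) := by
  simp_rw [mul_pow]
  rw [← Finset.mul_sum, Real.sqrt_mul (sq_nonneg t), Real.sqrt_sq ht]

/-- Schur's test: a nonnegative symmetric matrix with row sums at most `θ` has `ℓ²`-norm at most
`θ`. -/
theorem sqrt_sum_sq_mulVec_le {κ : Type*} [Fintype κ] {B : κ → κ → ℝ} {θ : ℝ} (hθ : 0 ≤ θ)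
    (hB0 : ∀ k i, 0 ≤ B k i) (hBs : ∀ k i, B k i = B i k) (hrow : ∀ i, ∑ k, B k i ≤ θ)
    (a : κ → ℝ) : √(∑ i, (∑ k, B k i * a k) ^ 2) ≤ θ * √(∑ i, a i ^ 2) := by
  rw [← Real.sqrt_sq hθ, ← Real.sqrt_mul (sq_nonneg θ)]
  refine Real.sqrt_le_sqrt ?_
  have h1 : ∀ i, (∑ k, B k i * a k) ^ 2 ≤ θ * ∑ k, B k i * a k ^ 2 := fun i => by
    refine (Finset.sum_sq_le_sum_mul_sum_of_sq_le_mul Finset.univ (fun k _ => hB0 k i)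
      (fun k _ => mul_nonneg (hB0 k i) (sq_nonneg (a k))) fun k _ => (by ring : _ = _).le).trans ?_
    exact mul_le_mul_of_nonneg_right (hrow i)
      (Finset.sum_nonneg fun k _ => mul_nonneg (hB0 k i) (sq_nonneg _))
  refine (Finset.sum_le_sum fun i _ => h1 i).trans ?_
  rw [← Finset.mul_sum, Finset.sum_comm, sq, mul_assoc]
  refine mul_le_mul_of_nonneg_left ?_ hθ
  rw [Finset.mul_sum]
  refine Finset.sum_le_sum fun k _ => ?_
  rw [← Finset.sum_mul]
  refine mul_le_mul_of_nonneg_right ?_ (sq_nonneg _)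
  simp_rw [hBs k]
  exact hrow k

variable {d : ℕ} {X : Type*} [Fintype X] [DecidableEq X]

/-- If the laws on `J` for boundary conditions differing only at `k` are coupled within `D J k`, and
the average of `D (I ∩ Λ) k i` over the cubes `I` that contain `i` but not `k` is controlled by a
symmetric matrix `B` of norm at most `θ < 1`, then the Gibbs sampler that resamples `I ∩ Λ` for a
uniformly chosen cube `I` is a contraction for `W2`, with rate `1 - (m ^ d / N) (1 - θ)`. Comparing
`p` with the invariant law of the sampler gives the bound. -/
theorem W2_sq_le_of_contraction (q : Ensemble d X) {m : ℕ} (hm : 1 ≤ m) (Λ : Finset (Site d))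
    (η : {i // i ∉ Λ} → X) {p : (Λ → X) → ℝ} (hp : p ∈ stdSimplex ℝ (Λ → X))
    (D : Finset (Site d) → Site d → Site d → ℝ)
    (hD : ∀ (J : Finset (Site d)) (k : {i // i ∉ J}) (y z : {i // i ∉ J} → X),
      (∀ i, i ≠ k → y i = z i) → CoupledWithin (q.law J y) (q.law J z) fun i => D J k i)
    (B : Site d → Site d → ℝ) {θ : ℝ} (hθ : 0 ≤ θ) (hθ1 : θ < 1) (hB0 : ∀ k i, 0 ≤ B k i)
    (hBs : ∀ k i, B k i = B i k) (hrow : ∀ (S : Finset (Site d)) i, ∑ k ∈ S, B k i ≤ θ)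
    (hcount : ∀ i ∈ Λ, ∀ k ∈ Λ, ∑ I ∈ cubes m Λ with i ∈ I ∧ k ∉ I, D (I ∩ Λ) k i ≤
      (m : ℝ) ^ d * B k i) :
    W2 p (q.law Λ η) ^ 2 ≤ 1 / (m : ℝ) ^ d * (1 / (1 - θ) ^ 2) * sumW2 q m Λ η p := by
  rcases Λ.eq_empty_or_nonempty with rfl | ⟨i₀, hi₀⟩
  · have hW := ((coupledWithin_varDist hp (q.law_mem ∅ η)).W2_le).antisymm
      (by simpa using W2_nonneg _ _)
    have h0 : W2 p (q.law ∅ η) = 0 := by simpa using hW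
    have h1 : cubes m (∅ : Finset (Site d)) = ∅ :=
      Finset.eq_empty_of_forall_notMem fun I hI => by simpa using (mem_cubes.1 hI).2
    simp [h0, sumW2, h1]
  set C := cubes m Λ
  set N : ℝ := ((C.card : ℕ) : ℝ) with hN
  set μ : ℝ := (m : ℝ) ^ d
  set W := W2 p (q.law Λ η)
  have hμ0 : 0 < μ := by positivity
  have hcard : ∀ i : Λ, ((C.filter fun I => (i : Site d) ∈ I).card : ℝ) = μ := fun i => by
    rw [card_filter_mem_cubes hm i.2]
    push_cast
    rfl
  have hμN : μ ≤ N := by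
    rw [← hcard ⟨i₀, hi₀⟩, hN]
    exact_mod_cast Finset.card_filter_le _ _
  have hN0 : 0 < N := hμ0.trans_le hμN
  have hw1 : ∑ _I ∈ C, N⁻¹ = 1 := by
    rw [Finset.sum_const, nsmul_eq_mul, mul_inv_cancel₀ hN0.ne']
  have hw0 : ∀ I ∈ C, 0 ≤ N⁻¹ := fun _ _ => inv_nonneg.2 hN0.le
  have hsub : ∀ I : Finset (Site d), I ∩ Λ ⊆ Λ := fun I => Finset.inter_subset_right
  have hmemI : ∀ (I : Finset (Site d)) (i : Λ), (i : Site d) ∈ I ∩ Λ ↔ (i : Site d) ∈ I :=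
    fun I i => by simp
  -- The distance from `p` to the law after one step of the sampler.
  choose b hb hb0 hbW using fun I => exists_coupledWithin_resample_self q (hsub I) η hp
  have hstep := CoupledWithin.mix C (fun _ => N⁻¹) hw0 hw1 (fun _ => p) _ b fun I _ _ => hb I
  have hpp : (fun x => ∑ _I ∈ C, N⁻¹ * p x) = p := by
    ext x
    rw [← Finset.sum_mul, hw1, one_mul]
  rw [hpp] at hstep
  have hbnorm : √(∑ i, (∑ I ∈ C, N⁻¹ * b I i) ^ 2) ≤ N⁻¹ * √(μ * sumW2 q m Λ η p) := by
    simp_rw [← Finset.mul_sum]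
    rw [sqrt_sum_mul_sq (inv_nonneg.2 hN0.le)]
    refine mul_le_mul_of_nonneg_left (Real.sqrt_le_sqrt ?_) (inv_nonneg.2 hN0.le)
    -- Cauchy–Schwarz over the `m ^ d` cubes through `i`, the only ones that move the site `i`.
    have h1 : ∀ i, (∑ I ∈ C, b I i) ^ 2 ≤ μ * ∑ I ∈ C, b I i ^ 2 := by
      intro i
      have h2 : ∑ I ∈ C, b I i = ∑ I ∈ C with (i : Site d) ∈ I, b I i := by
        rw [Finset.sum_filter]
        refine Finset.sum_congr rfl fun I _ => ?_
        split_ifs with h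
        · rfl
        · exact hb0 I i fun h' => h ((hmemI I i).1 h')
      rw [h2]
      refine sq_sum_le_card_mul_sum_sq.trans ?_
      rw [hcard i]
      exact mul_le_mul_of_nonneg_left (Finset.sum_le_sum_of_subset_of_nonneg
        (Finset.filter_subset _ _) fun _ _ _ => sq_nonneg _) hμ0.le
    refine (Finset.sum_le_sum fun i _ => h1 i).trans ?_
    rw [← Finset.mul_sum, Finset.sum_comm]
    exact mul_le_mul_of_nonneg_left (Finset.sum_le_sum fun I _ => hbW I) hμ0.le
  -- One step of the sampler contracts an optimal coupling of `p` and `q`.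
  obtain ⟨π, hπ, hπW⟩ := exists_coupling_W2 hp (q.law_mem Λ η)
  have hcontr := CoupledWithin.mix C (fun _ => N⁻¹) hw0 hw1 _ _ _
    fun I _ _ => coupledWithin_resample q η (hD (I ∩ Λ)) hπ
  have hqq : (fun x => ∑ I ∈ C, N⁻¹ * ∑ y, q.law Λ η y *
      push (patch (I ∩ Λ) y) (q.law (I ∩ Λ) (outside (I ∩ Λ) (join Λ y η))) x) = q.law Λ η := by
    ext x
    simp_rw [sum_mul_push_law q (hsub _) η]
    rw [← Finset.sum_mul, hw1, one_mul]
  rw [hqq] at hcontr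
  set a : Λ → ℝ := probNe π
  have ha0 : ∀ i, 0 ≤ a i := probNe_nonneg hπ.1.1
  have haW : √(∑ i, a i ^ 2) = W := by
    rw [hπW, Real.sqrt_sq (W2_nonneg _ _)]
  have hc := hcontr.mono (w := fun i =>
      (1 - μ / N) * a i + μ / N * ∑ k : Λ, B k i * a k) fun i => by
    have h1 : ∀ I ∈ C, (if (i : Site d) ∈ I ∩ Λ then
        ∑ k : Λ, (if (k : Site d) ∈ I ∩ Λ then 0 else D (I ∩ Λ) k i) * a k else a i) =
        (∑ k : Λ, (if (i : Site d) ∈ I ∧ (k : Site d) ∉ I then D (I ∩ Λ) k i else 0) * a k) +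
          (a i - if (i : Site d) ∈ I then a i else 0) := by
      intro I _
      simp_rw [hmemI]
      split_ifs with h
      · rw [sub_self, add_zero]
        refine Finset.sum_congr rfl fun k _ => ?_
        by_cases hk : (k : Site d) ∈ I <;> simp [h, hk]
      · simp [h]
    rw [← Finset.mul_sum, Finset.sum_congr rfl h1, Finset.sum_add_distrib,
      Finset.sum_sub_distrib, ← Finset.sum_filter, Finset.sum_const, Finset.sum_const,
      nsmul_eq_mul, nsmul_eq_mul, hcard i, Finset.sum_comm]
    have h2 : ∑ k : Λ, ∑ I ∈ C, (if (i : Site d) ∈ I ∧ (k : Site d) ∉ I then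
        D (I ∩ Λ) k i else 0) * a k ≤ μ * ∑ k : Λ, B k i * a k := by
      rw [Finset.mul_sum]
      refine Finset.sum_le_sum fun k _ => ?_
      rw [← Finset.sum_mul, ← Finset.sum_filter, ← mul_assoc]
      exact mul_le_mul_of_nonneg_right (hcount i i.2 k k.2) (ha0 k)
    have h3 : (1 - μ / N) * a i + μ / N * ∑ k : Λ, B k i * a k =
        N⁻¹ * (μ * (∑ k : Λ, B k i * a k) + (N * a i - μ * a i)) := by
      field_simp
      ring
    rw [h3]
    exact mul_le_mul_of_nonneg_left (add_le_add_left h2 _) (inv_nonneg.2 hN0.le)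
  have hcnorm : √(∑ i, ((1 - μ / N) * a i + μ / N * ∑ k : Λ, B k i * a k) ^ 2) ≤
      (1 - μ / N) * W + μ / N * (θ * W) := by
    have hμN1 : 0 ≤ 1 - μ / N := sub_nonneg.2 ((div_le_one hN0).2 hμN)
    refine (sqrt_sum_add_sq_le _ _).trans ?_
    rw [sqrt_sum_mul_sq hμN1, sqrt_sum_mul_sq (by positivity), haW]
    refine add_le_add le_rfl (mul_le_mul_of_nonneg_left ?_ (by positivity))
    rw [← haW]
    refine sqrt_sum_sq_mulVec_le (B := fun k i : Λ => B k i) hθ (fun k i => hB0 k i)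
      (fun k i => hBs k i) (fun i => ?_) a
    rw [Finset.sum_coe_sort Λ fun k => B k i]
    exact hrow Λ i
  have hW := (hstep.trans hc).W2_le.trans
    ((sqrt_sum_add_sq_le _ _).trans (add_le_add hbnorm hcnorm))
  have hS0 : 0 ≤ μ * sumW2 q m Λ η p :=
    mul_nonneg hμ0.le (Finset.sum_nonneg fun I _ => Finset.sum_nonneg fun y _ =>
      mul_nonneg (hp.1 y) (sq_nonneg _))
  have h1 : μ * (1 - θ) * W ≤ √(μ * sumW2 q m Λ η p) := by
    have h2 : N⁻¹ * √(μ * sumW2 q m Λ η p) + ((1 - μ / N) * W + μ / N * (θ * W)) =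
        W + N⁻¹ * (√(μ * sumW2 q m Λ η p) - μ * (1 - θ) * W) := by
      field_simp
      ring
    have hW' : W ≤ _ := hW
    rw [h2] at hW'
    have h3 : 0 ≤ N⁻¹ * (√(μ * sumW2 q m Λ η p) - μ * (1 - θ) * W) := by linarith
    exact sub_nonneg.1 (nonneg_of_mul_nonneg_right h3 (inv_pos.2 hN0))
  have hθ' : 0 < 1 - θ := sub_pos.2 hθ1
  have h2 := pow_le_pow_left₀ (mul_nonneg (by positivity) (W2_nonneg p (q.law Λ η))) h1 2
  rw [Real.sq_sqrt hS0] at h2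
  have h3 : 1 / μ * (1 / (1 - θ) ^ 2) * sumW2 q m Λ η p =
      μ * sumW2 q m Λ η p / (μ * (1 - θ)) ^ 2 := by
    field_simp
  rw [h3, le_div_iff₀ (by positivity)]
  linarith [h2, mul_pow (μ * (1 - θ)) W 2]

theorem sumW2_le_mul_sumVar (q : Ensemble d X) (m : ℕ) (Λ : Finset (Site d))
    (η : {i // i ∉ Λ} → X) {p : (Λ → X) → ℝ} (hp : p ∈ stdSimplex ℝ (Λ → X)) :
    sumW2 q m Λ η p ≤ (m : ℝ) ^ d * sumVar q m Λ η p := by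
  rw [sumW2, sumVar, Finset.mul_sum]
  refine Finset.sum_le_sum fun I hI => ?_
  rw [Finset.mul_sum]
  refine Finset.sum_le_sum fun y _ => ?_
  by_cases hy : p y = 0
  · simp [hy]
  rw [mul_left_comm]
  refine mul_le_mul_of_nonneg_left ?_ (hp.1 y)
  refine (W2_sq_le_card_mul_varDist_sq
    (condLaw_mem (J := I ∩ Λ) Finset.inter_subset_right hp.1 hy η) (q.law_mem _ _)).trans ?_
  refine mul_le_mul_of_nonneg_right ?_ (sq_nonneg _)
  rw [Fintype.card_coe]
  exact_mod_cast card_inter_le_of_mem_cubes hI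

theorem mul_sumW2_le_mul_sumVar (q : Ensemble d X) {m : ℕ} (hm : 1 ≤ m) (Λ : Finset (Site d))
    (η : {i // i ∉ Λ} → X) {p : (Λ → X) → ℝ} (hp : p ∈ stdSimplex ℝ (Λ → X)) (θ : ℝ) :
    1 / (m : ℝ) ^ d * (1 / (1 - θ) ^ 2) * sumW2 q m Λ η p ≤
      1 / (1 - θ) ^ 2 * sumVar q m Λ η p := by
  have hm0 : (m : ℝ) ^ d ≠ 0 := by positivity
  calc _ ≤ 1 / (m : ℝ) ^ d * (1 / (1 - θ) ^ 2) * ((m : ℝ) ^ d * sumVar q m Λ η p) :=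
        mul_le_mul_of_nonneg_left (sumW2_le_mul_sumVar q m Λ η hp) (by positivity)
    _ = _ := by
      rw [one_div ((m : ℝ) ^ d)]
      calc _ = ((m : ℝ) ^ d)⁻¹ * (m : ℝ) ^ d * (1 / (1 - θ) ^ 2 * sumVar q m Λ η p) := by ring
        _ = _ := by rw [inv_mul_cancel₀ hm0, one_mul]

/-- The proportion of the cubes containing `i` that separate `i` from a site `k` within distance
`R` of the cube. -/
theorem sum_filter_cubes_separating_le (hd : 1 ≤ d) {m : ℕ} (hm : 1 ≤ m) {Λ : Finset (Site d)}
    {i : Site d} (hi : i ∈ Λ) (k : Site d) (R : ℕ) {t : ℝ} (ht : 0 ≤ t) :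
    ∑ _I ∈ (cubes m Λ).filter (fun I => i ∈ I ∧ k ∉ I ∧ ∃ j ∈ I, rho k j ≤ R), t ≤
      (m : ℝ) ^ d * (min 1 ((d : ℝ) * R / m) * t) := by
  have hm0 : (0 : ℝ) < m := by exact_mod_cast hm
  rw [Finset.sum_const, nsmul_eq_mul, ← mul_assoc]
  refine mul_le_mul_of_nonneg_right ?_ ht
  rw [mul_min_of_nonneg _ _ (by positivity), mul_one]
  refine le_min ?_ ?_
  · rw [← Nat.cast_pow, ← card_filter_mem_cubes hm hi, Nat.cast_le]
    refine Finset.card_le_card fun I hI => ?_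
    rw [Finset.mem_filter] at hI ⊢
    exact ⟨hI.1, hI.2.1⟩
  · have h1 : (m : ℝ) ^ d * ((d : ℝ) * R / m) = d * (R * (m : ℝ) ^ (d - 1)) := by
      obtain ⟨e, rfl⟩ : ∃ e, d = e + 1 := ⟨d - 1, by omega⟩
      rw [Nat.add_sub_cancel, pow_succ]
      field_simp
    rw [h1]
    exact_mod_cast card_filter_cubes_separating_le Λ i k R

end Contraction

end SpinSystem

theorem mainTheorem6 {d : ℕ} (hd : 1 ≤ d) {X : Type*} [Fintype X] [DecidableEq X]
    (q : SpinSystem.Ensemble d X) (φ : ℕ → ℝ) (hφ : SpinSystem.IsCouplingFunction d φ)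
    (hq : SpinSystem.StronglyMixing q φ)
    (m : ℕ) (hm : 1 ≤ m)
    (Λ : Finset (SpinSystem.Site d)) (η : {i // i ∉ Λ} → X)
    (p : (Λ → X) → ℝ) (hp : p ∈ stdSimplex ℝ (Λ → X)) :
    (SpinSystem.Theta d φ m < 1 →
      SpinSystem.W2 p (q.law Λ η) ^ 2 ≤
          1 / (m : ℝ) ^ d * (1 / (1 - SpinSystem.Theta d φ m) ^ 2) *
            SpinSystem.sumW2 q m Λ η p ∧
        1 / (m : ℝ) ^ d * (1 / (1 - SpinSystem.Theta d φ m) ^ 2) *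
            SpinSystem.sumW2 q m Λ η p ≤
          1 / (1 - SpinSystem.Theta d φ m) ^ 2 * SpinSystem.sumVar q m Λ η p) ∧
    (∀ R : ℕ, SpinSystem.HasFiniteRange q R →
      SpinSystem.normPhi d φ * ((d : ℝ) * R / m) < 1 →
      SpinSystem.W2 p (q.law Λ η) ^ 2 ≤
          1 / (m : ℝ) ^ d * (1 / (1 - SpinSystem.normPhi d φ * ((d : ℝ) * R / m)) ^ 2) *
            SpinSystem.sumW2 q m Λ η p ∧
        1 / (m : ℝ) ^ d * (1 / (1 - SpinSystem.normPhi d φ * ((d : ℝ) * R / m)) ^ 2) *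
            SpinSystem.sumW2 q m Λ η p ≤
          1 / (1 - SpinSystem.normPhi d φ * ((d : ℝ) * R / m)) ^ 2 *
            SpinSystem.sumVar q m Λ η p) := by
  open SpinSystem in
  classical
  refine ⟨fun hΘ => ⟨?_, mul_sumW2_le_mul_sumVar q hm Λ η hp _⟩,
    fun R hR hR1 => ⟨?_, mul_sumW2_le_mul_sumVar q hm Λ η hp _⟩⟩
  · refine W2_sq_le_of_contraction q hm Λ η hp (fun _ k i => φ (rho k i))
      (fun J k y z h => hq.coupledWithin k y z h)
      (fun k i => min 1 ((d : ℝ) * rho k i / m) * φ (rho k i)) (Theta_nonneg hφ m) hΘ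
      (fun k i => mul_nonneg (by positivity) (hφ.nonneg _)) (fun k i => by rw [rho_comm])
      (fun S i => sum_min_mul_le_Theta hd hφ m S i) fun i hi k _ => ?_
    refine le_trans (le_of_eq (Finset.sum_congr (Finset.filter_congr fun I _ => ?_) fun _ _ => rfl))
      (sum_filter_cubes_separating_le hd hm hi k (rho k i) (hφ.nonneg _))
    exact ⟨fun h => ⟨h.1, h.2, i, h.1, le_rfl⟩, fun h => ⟨h.1, h.2.1⟩⟩
  · -- A site farther than `R` from `J` has no influence on the law on `J`.
    refine W2_sq_le_of_contraction q hm Λ η hp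
      (fun J k i => if ∃ j ∈ J, rho k j ≤ R then φ (rho k i) else 0) (fun J k y z h => ?_)
      (fun k i => (d : ℝ) * R / m * φ (rho k i))
      (mul_nonneg (normPhi_nonneg hφ) (by positivity)) hR1
      (fun k i => mul_nonneg (by positivity) (hφ.nonneg _)) (fun k i => by rw [rho_comm])
      (fun S i => ?_) fun i hi k _ => ?_
    · by_cases hk : ∃ j ∈ J, rho (k : Site d) j ≤ R
      · simp only [hk, if_true]
        exact hq.coupledWithin k y z h
      · simp only [hk, if_false]
        rw [hR J y z fun k' hk' => h k' fun hkk => hk (hkk ▸ hk')]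
        exact CoupledWithin.refl (q.law_mem J z)
    · rw [← Finset.mul_sum, mul_comm]
      exact mul_le_mul_of_nonneg_right (sum_rho_le_normPhi hφ S i) (by positivity)
    · have h0 := hφ.nonneg (rho k i)
      refine le_trans ?_ ((sum_filter_cubes_separating_le hd hm hi k R h0).trans
        (mul_le_mul_of_nonneg_left (mul_le_mul_of_nonneg_right (min_le_right _ _) h0)
          (by positivity)))
      rw [Finset.sum_filter, Finset.sum_filter]
      refine Finset.sum_le_sum fun I _ => ?_
      by_cases h1 : i ∈ I ∧ k ∉ I
      · by_cases h2 : ∃ j ∈ I ∩ Λ, rho k j ≤ R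
        · obtain ⟨j, hj, hjR⟩ := h2
          rw [if_pos h1, if_pos ⟨j, hj, hjR⟩,
            if_pos ⟨h1.1, h1.2, j, (Finset.mem_inter.1 hj).1, hjR⟩]
        · rw [if_pos h1, if_neg h2]
          split_ifs
          · exact h0
          · rfl
      · rw [if_neg h1, if_neg fun h => h1 ⟨h.1, h.2.1⟩]
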